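/- Let $k\in\mathbb N$ and $\mathbf n=(n_1,\dots,n_k)$ with $n_i\ge 1$. Let $\mathbb F_{n_i}^+$ be the free monoid on generators $g^i_1,\dots,g^i_{n_i}$ with identity $g^i_0$, let $W=\mathbb F_{n_1}^+\times\cdots\times\mathbb F_{n_k}^+$, and let $\mathbf g=(g_0^1,\dots,g_0^k)$. For a complex Hilbert space $\mathcal H$ and operators $\mathbf X=(X_{i,j})_{1\le i\le k,\,1\le j\le n_i}$ in $B(\mathcal H)$ put $X_{i,\alpha_i}=X_{i,j_1}\cdots X_{i,j_p}$ for $\alpha_i=g^i_{j_1}\cdots g^i_{j_p}$ (with $X_{i,g^i_0}=I$), and $\mathbf X_{\boldsymbol\alpha}=X_{1,\alpha_1}\cdots X_{k,\alpha_k}$ for $\boldsymbol\alpha\in W$. Let $\Phi_{X_i}(Y)=\sum_j X_{i,j}YX_{i,j}^*$. The regular polyball $\mathbf B_{\mathbf n}(\mathcal H)$ is the set of all $\mathbf X$ such that $X_{s,i}$ commutes with $X_{t,j}$ whenever $s\ne t$, $\|\sum_jX_{i,j}X_{i,j}^*\|^{1/2}<1$ for each $i$, and $(\mathrm{id}-\Phi_{X_1})\circ\cdots\circ(\mathrm{id}-\Phi_{X_k})(I)$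 is positive and invertible; $\mathbf B_{\mathbf n}(\mathcal H)^-$ is its norm closure. Let $\mathbf S=(\mathbf S_{i,j})$ be the universal model: on the Hilbert tensor product of full Fock spaces $F^2(H_{n_1})\otimes\cdots\otimes F^2(H_{n_k})$, with its orthonormal basis $(e_{\boldsymbol\beta})_{\boldsymbol\beta\in W}$, $\mathbf S_{i,j}$ maps $e_{\boldsymbol\beta}$ to $e_{\boldsymbol\beta'}$, where $\boldsymbol\beta'$ is $\boldsymbol\beta$ with $\beta_i$ replaced by $g^i_j\beta_i$. A set $\Lambda\subset W$ is *minimal* if no two distinct $\boldsymbol\omega,\boldsymbol\gamma\in\Lambda$ are such that every $\omega_i$ is a right divisor of $\gamma_i$, and no two distinct $\boldsymbol\omega,\boldsymbol\gamma\in\Lambda$ are such that every $\omega_i$ is a left divisor of $\gamma_i$; it is *orthogonal* if $\mathbf S_{\boldsymbol\beta}^*\mathbf S_{\boldsymbol\alpha}=0$ for all distinct $\boldsymbol\alpha,\boldsymbol\beta\in\Lambda$. Let $\{\Sigma_m\}_{m\ge0}$ be an exhaustion of $W$ by minimal and orthogonal sets, i.e. the $\Sigma_m$ are non-empty, pairwise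 disjoint, minimal and orthogonal, $\Sigma_0=\{\mathbf g\}$, and $\bigcup_m\Sigma_m=W$. Let $\mathcal K$ be a complex Hilbert space and $A_{(\boldsymbol\alpha)}\in B(\mathcal K)$, $\boldsymbol\alpha\in W$, be the coefficients of a free holomorphic function, i.e. the series $$F(\mathbf X)=\sum_{\mathbf p\in\mathbb Z_+^k}\ \sum_{|\alpha_1|=p_1,\dots,|\alpha_k|=p_k}A_{(\boldsymbol\alpha)}\otimes\mathbf X_{\boldsymbol\alpha}$$ converges in operator norm for every Hilbert space and every $\mathbf X$ in the regular polyball over it. Assume that for some infinite-dimensional Hilbert space $\mathcal H$ we have $F(0)\ge0$ and $\operatorname{Re}F(\mathbf X)\le I$ for all $\mathbf X\in\mathbf B_{\mathbf n}(\mathcal H)$. Write $A_0=A_{(\mathbf g)}$. Let $\{C_{(\boldsymbol\alpha)}\}_{\boldsymbol\alpha\in W}$ be bounded operators on a Hilbert space $\mathcal E$ with $C_0=C_{(\mathbf g)}$ satisfying $\|C_0\|\le1$. Sums over $\Sigma_m$ below are unconditional sums in the strong operator topology. (i) If $\sum_{m\ge1}\sup_{\boldsymbol\alpha\in\Sigma_m}\|C_{(\boldsymbol\alpha)}\|\le\frac12$,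 then for every Hilbert space $\mathcal G$ (in particular $\mathcal G=\mathcal H$) the sums $\sum_{\boldsymbol\alpha\in\Sigma_m}C_{(\boldsymbol\alpha)}\otimes A_{(\boldsymbol\alpha)}\otimes\mathbf X_{\boldsymbol\alpha}$, $\mathbf X\in\mathbf B_{\mathbf n}(\mathcal G)^-$, converge and $$\sum_{m=0}^\infty\ \sup_{\mathbf X\in\mathbf B_{\mathbf n}(\mathcal G)^-}\Big\|\sum_{\boldsymbol\alpha\in\Sigma_m}C_{(\boldsymbol\alpha)}\otimes A_{(\boldsymbol\alpha)}\otimes\mathbf X_{\boldsymbol\alpha}\Big\|\le\|A_0\|+\|I-A_0\|.$$ (ii) If the sums $\sum_{\boldsymbol\alpha\in\Sigma_m}C_{(\boldsymbol\alpha)}^*C_{(\boldsymbol\alpha)}$, $m\ge1$, converge and $\sum_{m\ge1}\big\|\sum_{\boldsymbol\alpha\in\Sigma_m}C_{(\boldsymbol\alpha)}^*C_{(\boldsymbol\alpha)}\big\|^{1/2}\le\frac12$, then the operators $T_m=\sum_{\boldsymbol\alpha\in\Sigma_m}C_{(\boldsymbol\alpha)}\otimes A_{(\boldsymbol\alpha)}\otimes\mathbf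 S_{\boldsymbol\alpha}$, $m\ge0$, exist, $\sum_m\|T_m\|<\infty$, and $$\Big\|\sum_{m=0}^\infty\sum_{\boldsymbol\alpha\in\Sigma_m}C_{(\boldsymbol\alpha)}\otimes A_{(\boldsymbol\alpha)}\otimes\mathbf S_{\boldsymbol\alpha}\Big\|\le1.$$ -/

import Mathlib

open scoped TensorProduct ENNReal

universe u v w x

/-! ### Hilbert tensor products and tensor products of bounded operators -/

/-- The Hilbert tensor product of two complex inner product spaces: the completion of the
algebraic tensor product for the inner product `⟪a ⊗ b, c ⊗ d⟫ = ⟪a, c⟫ * ⟪b, d⟫`. -/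
abbrev HilbertTensor (E F : Type*)
    [NormedAddCommGroup E] [InnerProductSpace ℂ E]
    [NormedAddCommGroup F] [InnerProductSpace ℂ F] : Type _ :=
  UniformSpace.Completion (E ⊗[ℂ] F)

/-- The elementary tensor `x ⊗ y` in the Hilbert tensor product. -/
noncomputable def hilbertTmul {E F : Type*}
    [NormedAddCommGroup E] [InnerProductSpace ℂ E]
    [NormedAddCommGroup F] [InnerProductSpace ℂ F] (x : E) (y : F) : HilbertTensor E F :=
  ((x ⊗ₜ[ℂ] y : E ⊗[ℂ] F) : UniformSpace.Completion (E ⊗[ℂ] F))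

/-- The tensor product `A ⊗ B` of two bounded operators, acting on the Hilbert tensor product:
the continuous extension of `x ⊗ y ↦ A x ⊗ B y`. -/
noncomputable def opTensor {E F : Type*}
    [NormedAddCommGroup E] [InnerProductSpace ℂ E]
    [NormedAddCommGroup F] [InnerProductSpace ℂ F]
    (A : E →L[ℂ] E) (B : F →L[ℂ] F) : HilbertTensor E F →L[ℂ] HilbertTensor E F :=
  ((UniformSpace.Completion.toComplL (𝕜 := ℂ) (E := E ⊗[ℂ] F)) ∘L
    TensorProduct.mapL A B).extend (UniformSpace.Completion.toComplL (𝕜 := ℂ) (E := E ⊗[ℂ] F))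

theorem opTensor_coe {E F : Type*}
    [NormedAddCommGroup E] [InnerProductSpace ℂ E]
    [NormedAddCommGroup F] [InnerProductSpace ℂ F]
    (A : E →L[ℂ] E) (B : F →L[ℂ] F) (z : E ⊗[ℂ] F) :
    opTensor A B (z : HilbertTensor E F) = (TensorProduct.mapL A B z : E ⊗[ℂ] F) :=
  ContinuousLinearMap.extend_eq
    (e := UniformSpace.Completion.toComplL (𝕜 := ℂ) (E := E ⊗[ℂ] F)) _
    UniformSpace.Completion.denseRange_coe
    (UniformSpace.Completion.isUniformInducing_coe _) z

theorem opTensor_hilbertTmul {E F : Type*}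
    [NormedAddCommGroup E] [InnerProductSpace ℂ E]
    [NormedAddCommGroup F] [InnerProductSpace ℂ F]
    (A : E →L[ℂ] E) (B : F →L[ℂ] F) (x : E) (y : F) :
    opTensor A B (hilbertTmul x y) = hilbertTmul (A x) (B y) :=
  opTensor_coe A B (x ⊗ₜ[ℂ] y)

/-- The (possibly infinite) family `T` of bounded operators sums unconditionally to `S` in the
strong operator topology. -/
def HasStrongSum {ι V : Type*} [NormedAddCommGroup V] [InnerProductSpace ℂ V]
    (T : ι → V →L[ℂ] V) (S : V →L[ℂ] V) : Prop :=
  ∀ v, HasSum (fun i => T i v) (S v)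

/-! ### Words, minimal sets -/

/-- The monoid `𝔽_{n₁}⁺ × ⋯ × 𝔽_{n_k}⁺`, where `𝔽_m⁺` is the free monoid on `m` generators.
Its unit `1` is the tuple of empty words. -/
abbrev PolyWord {k : ℕ} (n : Fin k → ℕ) : Type :=
  (i : Fin k) → FreeMonoid (Fin (n i))

/-- The generator `g_j^i`, placed in the `i`-th factor. -/
def PolyWord.gen {k : ℕ} {n : Fin k → ℕ} (i : Fin k) (j : Fin (n i)) : PolyWord n :=
  Pi.mulSingle i (FreeMonoid.of j)

theorem polyWord_multiDegree_finite {k : ℕ} (n : Fin k → ℕ) (p : Fin k → ℕ) :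
    {α : PolyWord n | ∀ i, (α i).length = p i}.Finite := by
  have h : {α : PolyWord n | ∀ i, (α i).length = p i} =
      Set.univ.pi (fun i => {w : FreeMonoid (Fin (n i)) | w.length = p i}) := by
    ext α
    simp
  rw [h]
  exact Set.Finite.pi (fun i => List.finite_length_eq (Fin (n i)) (p i))

/-- `Λ_p`: the tuples of words `(α₁, …, α_k)` with `|α_i| = p_i` for every `i`. -/
noncomputable def PolyWord.ofMultiDegree {k : ℕ} (n : Fin k → ℕ) (p : Fin k → ℕ) :
    Finset (PolyWord n) :=
  (polyWord_multiDegree_finite n p).toFinset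

/-- `ω ≤_r γ`: each `ω_i` is a right divisor of `γ_i`. -/
def PolyWord.RightLE {k : ℕ} {n : Fin k → ℕ} (ω γ : PolyWord n) : Prop :=
  ∀ i, ∃ σ, γ i = σ * ω i

/-- `ω ≤_l γ`: each `ω_i` is a left divisor of `γ_i`. -/
def PolyWord.LeftLE {k : ℕ} {n : Fin k → ℕ} (ω γ : PolyWord n) : Prop :=
  ∀ i, ∃ σ, γ i = ω i * σ

/-- A set of tuples of words is minimal if it is an antichain both for `≤_r` and for `≤_l`. -/
def IsMinimalSet {k : ℕ} {n : Fin k → ℕ} (Λ : Set (PolyWord n)) : Prop :=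
  (∀ ω ∈ Λ, ∀ γ ∈ Λ, ω.RightLE γ → ω = γ) ∧ (∀ ω ∈ Λ, ∀ γ ∈ Λ, ω.LeftLE γ → ω = γ)

/-! ### Tuples of operators, the regular polyball -/

/-- `B(H)^{n₁} × ⋯ × B(H)^{n_k}`. -/
abbrev OpTuple {k : ℕ} (n : Fin k → ℕ) (H : Type*)
    [NormedAddCommGroup H] [InnerProductSpace ℂ H] : Type _ :=
  (i : Fin k) → Fin (n i) → (H →L[ℂ] H)

/-- `X_α = X_{1,α₁} ⋯ X_{k,α_k}`, where `X_{i,w} = X_{i,j₁} ⋯ X_{i,j_p}` for the word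
`w = g_{j₁} ⋯ g_{j_p}`. -/
noncomputable def OpTuple.word {k : ℕ} {n : Fin k → ℕ} {H : Type*}
    [NormedAddCommGroup H] [InnerProductSpace ℂ H] (X : OpTuple n H) (α : PolyWord n) :
    H →L[ℂ] H :=
  (List.ofFn fun i => FreeMonoid.lift (X i) (α i)).prod

/-- The map `Φ_{X_i}(Y) = ∑_j X_{i,j} Y X_{i,j}^*`. -/
noncomputable def OpTuple.cpMap {k : ℕ} {n : Fin k → ℕ} {H : Type*}
    [NormedAddCommGroup H] [InnerProductSpace ℂ H] [CompleteSpace H] (X : OpTuple n H)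
    (i : Fin k) : Module.End ℂ (H →L[ℂ] H) :=
  ∑ j, LinearMap.mulLeftRight ℂ (X i j, ContinuousLinearMap.adjoint (X i j))

theorem OpTuple.cpMap_apply {k : ℕ} {n : Fin k → ℕ} {H : Type*}
    [NormedAddCommGroup H] [InnerProductSpace ℂ H] [CompleteSpace H] (X : OpTuple n H)
    (i : Fin k) (Y : H →L[ℂ] H) :
    X.cpMap i Y = ∑ j, X i j * Y * ContinuousLinearMap.adjoint (X i j) := by
  simp [OpTuple.cpMap]

/-- The defect map `Δ_X = (id - Φ_{X₁}) ∘ ⋯ ∘ (id - Φ_{X_k})`. -/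
noncomputable def OpTuple.defectMap {k : ℕ} {n : Fin k → ℕ} {H : Type*}
    [NormedAddCommGroup H] [InnerProductSpace ℂ H] [CompleteSpace H] (X : OpTuple n H) :
    Module.End ℂ (H →L[ℂ] H) :=
  (List.ofFn fun i => 1 - X.cpMap i).prod

/-- The regular polyball `B_n(H)`: the tuples `X` such that the entries of `X_s` and `X_t` commute
for `s ≠ t`, each `X_i` is a strict row contraction, and the defect operator `Δ_X(I)` is positive
and invertible. -/
def regularPolyball {k : ℕ} (n : Fin k → ℕ) (H : Type*)
    [NormedAddCommGroup H] [InnerProductSpace ℂ H] [CompleteSpace H] : Set (OpTuple n H) :=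
  {X | (∀ s t, s ≠ t → ∀ i j, Commute (X s i) (X t j)) ∧
    (∀ i, ‖∑ j, X i j * ContinuousLinearMap.adjoint (X i j)‖ ^ (1 / 2 : ℝ) < 1) ∧
    0 ≤ X.defectMap 1 ∧ IsUnit (X.defectMap 1)}

/-! ### The universal model -/

/-- The Hilbert space `F²(H_{n₁}) ⊗ ⋯ ⊗ F²(H_{n_k})` (tensor product of full Fock spaces),
described in its canonical orthonormal basis `e_α = e¹_{α₁} ⊗ ⋯ ⊗ eᵏ_{α_k}` indexed by the tuples
of words `α`. -/
abbrev PolyFock {k : ℕ} (n : Fin k → ℕ) : Type :=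
  lp (fun _ : PolyWord n => ℂ) 2

open scoped Classical in
/-- The basis vector `e_α`. -/
noncomputable def PolyFock.basisVec {k : ℕ} {n : Fin k → ℕ} (α : PolyWord n) : PolyFock n :=
  lp.single 2 α (1 : ℂ)

theorem PolyFock.orthonormal_basisVec {k : ℕ} {n : Fin k → ℕ} :
    Orthonormal ℂ (PolyFock.basisVec : PolyWord n → PolyFock n) := by
  classical
  rw [orthonormal_iff_ite]
  intro α β
  rw [PolyFock.basisVec, PolyFock.basisVec, lp.inner_single_left]
  by_cases h : α = β <;> simp [h]

/-- The left creation operator `S_{i,j}`: the isometry `e_β ↦ e_{g_j^i β}`. -/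
noncomputable def creation {k : ℕ} {n : Fin k → ℕ} (i : Fin k) (j : Fin (n i)) :
    PolyFock n →L[ℂ] PolyFock n :=
  ((PolyFock.orthonormal_basisVec.comp (fun β : PolyWord n => PolyWord.gen i j * β)
    (mul_right_injective _)).orthogonalFamily.linearIsometry).toContinuousLinearMap

theorem creation_basisVec {k : ℕ} {n : Fin k → ℕ} (i : Fin k) (j : Fin (n i)) (β : PolyWord n) :
    creation i j (PolyFock.basisVec β) = PolyFock.basisVec (PolyWord.gen i j * β) := by
  classical
  have h := (PolyFock.orthonormal_basisVec.comp (fun β : PolyWord n => PolyWord.gen i j * β)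
    (mul_right_injective _)).orthogonalFamily.linearIsometry_apply_single (i := β) (1 : ℂ)
  simpa [PolyFock.basisVec, creation] using h

/-- The universal model `S = (S_{i,j})` of the regular polyball. -/
noncomputable def universalModel {k : ℕ} (n : Fin k → ℕ) : OpTuple n (PolyFock n) :=
  fun i j => creation i j

/-! ### Orthogonal sets and exhaustions -/

/-- A set `Λ` of tuples of words is orthogonal if the isometries `S_α`, `α ∈ Λ`, have pairwise
orthogonal ranges. -/
def IsOrthogonalSet {k : ℕ} {n : Fin k → ℕ} (Λ : Set (PolyWord n)) : Prop :=
  ∀ α ∈ Λ, ∀ β ∈ Λ, α ≠ β →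
    ContinuousLinearMap.adjoint ((universalModel n).word β) * (universalModel n).word α = 0

/-- An exhaustion of `𝔽_{n₁}⁺ × ⋯ × 𝔽_{n_k}⁺` by minimal and orthogonal sets. -/
structure IsMinimalOrthogonalExhaustion {k : ℕ} {n : Fin k → ℕ} (Sig : ℕ → Set (PolyWord n)) :
    Prop where
  zero : Sig 0 = {1}
  nonempty : ∀ m, (Sig m).Nonempty
  disjoint : ∀ m m', m ≠ m' → Disjoint (Sig m) (Sig m')
  iUnion : ⋃ m, Sig m = Set.univ
  minimal : ∀ m, IsMinimalSet (Sig m)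
  orthogonal : ∀ m, IsOrthogonalSet (Sig m)

/-! ### Free holomorphic functions with operator coefficients -/

/-- The multi-homogeneous part `∑_{α ∈ Λ_p} A_α ⊗ X_α` of `∑_α A_α ⊗ X_α`. -/
noncomputable def homogeneousPart {k : ℕ} {n : Fin k → ℕ} {K H : Type*}
    [NormedAddCommGroup K] [InnerProductSpace ℂ K]
    [NormedAddCommGroup H] [InnerProductSpace ℂ H]
    (A : PolyWord n → K →L[ℂ] K) (X : OpTuple n H) (p : Fin k → ℕ) :
    HilbertTensor K H →L[ℂ] HilbertTensor K H :=
  ∑ α ∈ PolyWord.ofMultiDegree n p, opTensor (A α) (X.word α)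

/-- The coefficients `A` define a free holomorphic function on the abstract regular polyball:
`∑_p ∑_{α ∈ Λ_p} A_α ⊗ X_α` converges in the operator norm for every Hilbert space `H` and every
`X ∈ B_n(H)`. -/
def IsFreeHolomorphic {k : ℕ} {n : Fin k → ℕ} {K : Type v}
    [NormedAddCommGroup K] [InnerProductSpace ℂ K] (A : PolyWord n → K →L[ℂ] K) : Prop :=
  ∀ (H : Type u) [NormedAddCommGroup H] [InnerProductSpace ℂ H] [CompleteSpace H],
    ∀ X ∈ regularPolyball n H, Summable (homogeneousPart A X)

/-- The value `F(X) = ∑_p ∑_{α ∈ Λ_p} A_α ⊗ X_α` at `X ∈ B_n(H)` of the free holomorphic function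
with coefficients `A`. -/
noncomputable def freeEval {k : ℕ} {n : Fin k → ℕ} {K H : Type*}
    [NormedAddCommGroup K] [InnerProductSpace ℂ K]
    [NormedAddCommGroup H] [InnerProductSpace ℂ H]
    (A : PolyWord n → K →L[ℂ] K) (X : OpTuple n H) :
    HilbertTensor K H →L[ℂ] HilbertTensor K H :=
  ∑' p, homogeneousPart A X p

/-!
Write `B = I - A_0`. The free holomorphic function `F` enters only through its values at copies
`r J S J^*` in `H` of the scaled universal model, `J` being an isometry of the Fock space into the
infinite-dimensional space `H` (`exists_isometry_of_infinite`). Such tuples doubly commute, so the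
defect operator is the product of the commuting positive invertible operators `I - Φ_{X_i}(I)`, and
the tuple lies in the regular polyball (`scaledModel_mem_regularPolyball`). The matrix entry of
`F(r S)` from `e_β` to `e_{γβ}` is `r^{|γ|} A_γ`. Compressing `Re F ≤ I` to `e_1` and to the `e_α`
with `α` in a finite antichain for right divisibility, only the first row and column have
off-diagonal entries, and `r → 1` yields (`re_sum_inner_coeff_le`)
`Re ∑ ⟪A_α x, y_α⟫ ≤ ⟪B x, x⟫ + ∑ ⟪B y_α, y_α⟫`.
The choice of `y_α` as a multiple of `A_α x` gives `∑ ‖A_α x‖² ≤ (2 ‖B‖)² ‖x‖²`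
(`sum_norm_coeff_sq_le`), while for a single `α` one gets `A_α = b Z b` with `‖Z‖ ≤ 2` whenever
`b² = B + ε` with `b` self-adjoint and invertible (`norm_conj_inv_coeff_le`).

The other ingredient is that `[X_α : α ∈ Λ]` is a row contraction when `Λ` is orthogonal and `X`
lies in the closed polyball (`sum_norm_adjoint_word_sq_le_of_mem_closure`). With the defect
operator `Δ`, telescoping `∏ (∑_{p<N} Φ_i^p) ∏ (1 - Φ_i) = ∏ (1 - Φ_i^N)` shows
`‖h‖² = ∑_γ ⟪Δ X_γ^* h, X_γ^* h⟫`; here `‖X_α^* h‖²` is the part of the sum over `γ ∈ α W`, and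
orthogonality of `Λ` makes these sets disjoint.

A row contraction times a bounded column is a strongly convergent sum
(`exists_hasStrongSum_row_mul_column`). For `m ≥ 1` the column `(C_α ⊗ A_α)` over `Σ_m` is bounded
by `2 ‖B‖ sup ‖C_α‖`, which gives the first inequality. In the second one the sum of all terms is
`a C_0 a + b M b` with `a² = A_0`, `b² = B + ε`, `‖C_0‖ ≤ 1` and
`‖M‖ ≤ 2 ∑ ‖∑ C_α^* C_α‖^{1/2} ≤ 1`, and since `a² + b² = 1 + ε` its norm is at most `1 + ε`.
-/

open ContinuousLinearMap

/-! ### Tensor products of operators as ampliations -/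

section Tensor

variable {E F : Type*} [NormedAddCommGroup E] [InnerProductSpace ℂ E]
  [NormedAddCommGroup F] [InnerProductSpace ℂ F]

/-- Bounded operators on a Hilbert tensor product agree if they agree on elementary tensors. -/
theorem HilbertTensor.ext_op {V : Type*} [NormedAddCommGroup V] [NormedSpace ℂ V]
    {S T : HilbertTensor E F →L[ℂ] V}
    (h : ∀ x y, S (hilbertTmul x y) = T (hilbertTmul x y)) : S = T := by
  ext z
  induction z using UniformSpace.Completion.induction_on with
  | hp => exact isClosed_eq S.continuous T.continuous
  | ih z =>
    induction z using TensorProduct.induction_on with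
    | zero => rw [UniformSpace.Completion.coe_zero, map_zero, map_zero]
    | tmul x y => exact h x y
    | add a b ha hb => rw [UniformSpace.Completion.coe_add, map_add, map_add, ha, hb]

theorem inner_hilbertTmul (x x' : E) (y y' : F) :
    inner ℂ (hilbertTmul x y) (hilbertTmul x' y') = inner ℂ x x' * inner ℂ y y' := by
  rw [hilbertTmul, hilbertTmul, UniformSpace.Completion.inner_coe, TensorProduct.inner_tmul]

theorem hilbertTmul_add_left (x x' : E) (y : F) :
    hilbertTmul (x + x') y = hilbertTmul x y + hilbertTmul x' y := by
  simp only [hilbertTmul, TensorProduct.add_tmul, UniformSpace.Completion.coe_add]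

theorem hilbertTmul_add_right (x : E) (y y' : F) :
    hilbertTmul x (y + y') = hilbertTmul x y + hilbertTmul x y' := by
  simp only [hilbertTmul, TensorProduct.tmul_add, UniformSpace.Completion.coe_add]

theorem hilbertTmul_smul_left (c : ℂ) (x : E) (y : F) :
    hilbertTmul (c • x) y = c • hilbertTmul x y := by
  simp only [hilbertTmul, ← TensorProduct.smul_tmul', UniformSpace.Completion.coe_smul]

theorem hilbertTmul_smul_right (c : ℂ) (x : E) (y : F) :
    hilbertTmul x (c • y) = c • hilbertTmul x y := by
  simp only [hilbertTmul, TensorProduct.tmul_smul, UniformSpace.Completion.coe_smul]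

theorem opTensor_mul (A A' : E →L[ℂ] E) (B B' : F →L[ℂ] F) :
    opTensor (A * A') (B * B') = opTensor A B * opTensor A' B' :=
  HilbertTensor.ext_op fun x y => by simp [opTensor_hilbertTmul]

theorem opTensor_one : opTensor (1 : E →L[ℂ] E) (1 : F →L[ℂ] F) = 1 :=
  HilbertTensor.ext_op fun x y => by simp [opTensor_hilbertTmul]

theorem opTensor_add_left (A A' : E →L[ℂ] E) (B : F →L[ℂ] F) :
    opTensor (A + A') B = opTensor A B + opTensor A' B :=
  HilbertTensor.ext_op fun x y => by simp [opTensor_hilbertTmul, hilbertTmul_add_left]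

theorem opTensor_add_right (A : E →L[ℂ] E) (B B' : F →L[ℂ] F) :
    opTensor A (B + B') = opTensor A B + opTensor A B' :=
  HilbertTensor.ext_op fun x y => by simp [opTensor_hilbertTmul, hilbertTmul_add_right]

theorem opTensor_smul_left (c : ℂ) (A : E →L[ℂ] E) (B : F →L[ℂ] F) :
    opTensor (c • A) B = c • opTensor A B :=
  HilbertTensor.ext_op fun x y => by simp [opTensor_hilbertTmul, hilbertTmul_smul_left]

theorem opTensor_smul_right (c : ℂ) (A : E →L[ℂ] E) (B : F →L[ℂ] F) :
    opTensor A (c • B) = c • opTensor A B :=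
  HilbertTensor.ext_op fun x y => by simp [opTensor_hilbertTmul, hilbertTmul_smul_right]

theorem opTensor_zero_right (A : E →L[ℂ] E) : opTensor A (0 : F →L[ℂ] F) = 0 := by
  simpa using opTensor_smul_right (0 : ℂ) A (0 : F →L[ℂ] F)

theorem opTensor_eq_mul (A : E →L[ℂ] E) (B : F →L[ℂ] F) :
    opTensor A B = opTensor 1 B * opTensor A 1 := by
  rw [← opTensor_mul, one_mul, mul_one]

theorem opTensor_adjoint [CompleteSpace E] [CompleteSpace F] (A : E →L[ℂ] E) (B : F →L[ℂ] F) :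
    adjoint (opTensor A B) = opTensor (adjoint A) (adjoint B) := by
  refine HilbertTensor.ext_op fun x y => ?_
  refine ext_inner_right ℂ fun z => ?_
  induction z using UniformSpace.Completion.induction_on with
  | hp => exact isClosed_eq (by fun_prop) (by fun_prop)
  | ih z =>
    induction z using TensorProduct.induction_on with
    | zero => rw [UniformSpace.Completion.coe_zero, inner_zero_right, inner_zero_right]
    | tmul x' y' =>
      change inner ℂ _ (hilbertTmul x' y') = inner ℂ _ (hilbertTmul x' y')
      rw [adjoint_inner_left, opTensor_hilbertTmul, opTensor_hilbertTmul, inner_hilbertTmul,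
        inner_hilbertTmul, adjoint_inner_left, adjoint_inner_left]
    | add a b ha hb => rw [UniformSpace.Completion.coe_add, inner_add_right, inner_add_right, ha, hb]

/-- The ampliation `A ↦ A ⊗ I` as a unital `*`-homomorphism; as such it is contractive and
monotone. -/
noncomputable def ampLeft [CompleteSpace E] [CompleteSpace F] :
    (E →L[ℂ] E) →⋆ₐ[ℂ] (HilbertTensor E F →L[ℂ] HilbertTensor E F) where
  toAlgHom := AlgHom.ofLinearMap
    { toFun := fun A => opTensor A 1
      map_add' := fun A A' => opTensor_add_left A A' 1
      map_smul' := fun c A => opTensor_smul_left c A 1 } opTensor_one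
    fun A A' => by simpa using opTensor_mul A A' (1 : F →L[ℂ] F) 1
  map_star' A := by
    change opTensor (adjoint A) 1 = adjoint (opTensor A 1)
    rw [opTensor_adjoint, ← star_eq_adjoint, ← star_eq_adjoint, star_one]

/-- The ampliation `B ↦ I ⊗ B` as a unital `*`-homomorphism. -/
noncomputable def ampRight [CompleteSpace E] [CompleteSpace F] :
    (F →L[ℂ] F) →⋆ₐ[ℂ] (HilbertTensor E F →L[ℂ] HilbertTensor E F) where
  toAlgHom := AlgHom.ofLinearMap
    { toFun := fun B => opTensor 1 B
      map_add' := fun B B' => opTensor_add_right 1 B B'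
      map_smul' := fun c B => opTensor_smul_right c 1 B } opTensor_one
    fun B B' => by simpa using opTensor_mul (1 : E →L[ℂ] E) 1 B B'
  map_star' B := by
    change opTensor 1 (adjoint B) = adjoint (opTensor 1 B)
    rw [opTensor_adjoint, ← star_eq_adjoint, ← star_eq_adjoint, star_one]

theorem ampLeft_apply [CompleteSpace E] [CompleteSpace F] (A : E →L[ℂ] E) :
    (ampLeft A : HilbertTensor E F →L[ℂ] HilbertTensor E F) = opTensor A 1 := rfl

theorem ampRight_apply [CompleteSpace E] [CompleteSpace F] (B : F →L[ℂ] F) :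
    (ampRight B : HilbertTensor E F →L[ℂ] HilbertTensor E F) = opTensor 1 B := rfl

theorem norm_ampLeft_le [CompleteSpace E] [CompleteSpace F] (A : E →L[ℂ] E) :
    ‖(ampLeft A : HilbertTensor E F →L[ℂ] HilbertTensor E F)‖ ≤ ‖A‖ :=
  NonUnitalStarAlgHom.norm_apply_le (ampLeft : (E →L[ℂ] E) →⋆ₐ[ℂ] _) A

theorem norm_ampRight_le [CompleteSpace E] [CompleteSpace F] (B : F →L[ℂ] F) :
    ‖(ampRight B : HilbertTensor E F →L[ℂ] HilbertTensor E F)‖ ≤ ‖B‖ :=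
  NonUnitalStarAlgHom.norm_apply_le (ampRight : (F →L[ℂ] F) →⋆ₐ[ℂ] _) B

theorem norm_opTensor_le [CompleteSpace E] [CompleteSpace F] (A : E →L[ℂ] E) (B : F →L[ℂ] F) :
    ‖opTensor A B‖ ≤ ‖A‖ * ‖B‖ := by
  rw [opTensor_eq_mul, ← ampLeft_apply, ← ampRight_apply, mul_comm ‖A‖]
  refine (norm_mul_le (ampRight B : HilbertTensor E F →L[ℂ] HilbertTensor E F) _).trans ?_
  gcongr
  · exact norm_ampRight_le B
  · exact norm_ampLeft_le A

end Tensor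

/-! ### Rows and columns of operators -/

section RowColumn

variable {V : Type*} [NormedAddCommGroup V] [InnerProductSpace ℂ V] [CompleteSpace V]

theorem re_inner_sum_adjoint_mul {ι : Type*} (s : Finset ι) (L : ι → V →L[ℂ] V) (v : V) :
    (inner ℂ ((∑ i ∈ s, adjoint (L i) * L i) v) v).re = ∑ i ∈ s, ‖L i v‖ ^ 2 := by
  simp only [sum_apply, sum_inner, Complex.re_sum, mul_apply_eq_comp, adjoint_inner_left]
  exact Finset.sum_congr rfl fun i _ => (inner_self_eq_norm_sq (𝕜 := ℂ) (L i v))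

theorem sum_norm_sq_le_norm_mul {ι : Type*} (s : Finset ι) (L : ι → V →L[ℂ] V) (v : V) :
    ∑ i ∈ s, ‖L i v‖ ^ 2 ≤ ‖∑ i ∈ s, adjoint (L i) * L i‖ * ‖v‖ ^ 2 := by
  rw [← re_inner_sum_adjoint_mul]
  calc _ ≤ ‖inner ℂ ((∑ i ∈ s, adjoint (L i) * L i) v) v‖ := Complex.re_le_norm _
    _ ≤ ‖(∑ i ∈ s, adjoint (L i) * L i) v‖ * ‖v‖ := norm_inner_le_norm _ _
    _ ≤ ‖∑ i ∈ s, adjoint (L i) * L i‖ * ‖v‖ * ‖v‖ := by gcongr; exact le_opNorm _ _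
    _ = _ := by ring

/-- If `∑ R_i R_i^* ≤ c`, the row operator `(v_i) ↦ ∑ R_i v_i` has norm at most `√c`. -/
theorem norm_sum_apply_sq_le {ι : Type*} (s : Finset ι) (R : ι → V →L[ℂ] V) (v : ι → V) {c : ℝ}
    (hc : 0 ≤ c) (hR : ∀ h, ∑ i ∈ s, ‖adjoint (R i) h‖ ^ 2 ≤ c * ‖h‖ ^ 2) :
    ‖∑ i ∈ s, R i (v i)‖ ^ 2 ≤ c * ∑ i ∈ s, ‖v i‖ ^ 2 := by
  set w := ∑ i ∈ s, R i (v i) with hw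
  have h1 : ‖w‖ ^ 2 ≤ ∑ i ∈ s, ‖v i‖ * ‖adjoint (R i) w‖ := by
    rw [← inner_self_eq_norm_sq (𝕜 := ℂ) w]
    nth_rw 1 [hw]
    rw [sum_inner, map_sum]
    refine Finset.sum_le_sum fun i _ => ?_
    rw [← adjoint_inner_right]
    exact (Complex.re_le_norm _).trans (norm_inner_le_norm _ _)
  have h2 : (‖w‖ ^ 2) ^ 2 ≤ (∑ i ∈ s, ‖v i‖ ^ 2) * (c * ‖w‖ ^ 2) :=
    calc (‖w‖ ^ 2) ^ 2 ≤ (∑ i ∈ s, ‖v i‖ * ‖adjoint (R i) w‖) ^ 2 := by gcongr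
      _ ≤ (∑ i ∈ s, ‖v i‖ ^ 2) * ∑ i ∈ s, ‖adjoint (R i) w‖ ^ 2 :=
        Finset.sum_mul_sq_le_sq_mul_sq _ _ _
      _ ≤ _ := mul_le_mul_of_nonneg_left (hR w) (by positivity)
  rcases (sq_nonneg ‖w‖).eq_or_lt with h | h
  · rw [← h]; positivity
  · refine le_of_mul_le_mul_right ?_ h
    calc ‖w‖ ^ 2 * ‖w‖ ^ 2 = (‖w‖ ^ 2) ^ 2 := by ring
      _ ≤ _ := h2
      _ = _ := by ring

/-- The operator `∑ L_i^* L_i` is bounded by a scalar as soon as its quadratic form is. -/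
theorem norm_sum_adjoint_mul_le {ι : Type*} (s : Finset ι) (L : ι → V →L[ℂ] V) {c : ℝ}
    (hc : 0 ≤ c) (h : ∀ v, ∑ i ∈ s, ‖L i v‖ ^ 2 ≤ c * ‖v‖ ^ 2) :
    ‖∑ i ∈ s, adjoint (L i) * L i‖ ≤ c := by
  refine opNorm_le_bound _ hc fun v => le_of_sq_le_sq ?_ (by positivity)
  have := norm_sum_apply_sq_le s (fun i => adjoint (L i)) (fun i => L i v) hc
    (by simpa only [adjoint_adjoint] using h)
  calc ‖(∑ i ∈ s, adjoint (L i) * L i) v‖ ^ 2 = ‖∑ i ∈ s, adjoint (L i) (L i v)‖ ^ 2 := by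
        simp [sum_apply]
    _ ≤ c * ∑ i ∈ s, ‖L i v‖ ^ 2 := this
    _ ≤ c * (c * ‖v‖ ^ 2) := mul_le_mul_of_nonneg_left (h v) hc
    _ = _ := by ring

/-- Column bounds pass through `*`-homomorphisms, in particular through ampliations. -/
theorem StarAlgHom.sum_norm_sq_le {W : Type*} [NormedAddCommGroup W] [InnerProductSpace ℂ W]
    [CompleteSpace W] (φ : (V →L[ℂ] V) →⋆ₐ[ℂ] (W →L[ℂ] W)) {ι : Type*} (s : Finset ι)
    (L : ι → V →L[ℂ] V) {c : ℝ} (hc : 0 ≤ c) (h : ∀ v, ∑ i ∈ s, ‖L i v‖ ^ 2 ≤ c * ‖v‖ ^ 2)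
    (w : W) : ∑ i ∈ s, ‖φ (L i) w‖ ^ 2 ≤ c * ‖w‖ ^ 2 := by
  refine (sum_norm_sq_le_norm_mul s (fun i => φ (L i)) w).trans ?_
  gcongr
  have : ∑ i ∈ s, adjoint (φ (L i)) * φ (L i) = φ (∑ i ∈ s, adjoint (L i) * L i) := by
    rw [map_sum]
    exact Finset.sum_congr rfl fun i _ => by
      rw [map_mul, ← star_eq_adjoint, ← star_eq_adjoint, map_star]
  rw [this]
  exact (NonUnitalStarAlgHom.norm_apply_le φ _).trans (norm_sum_adjoint_mul_le s L hc h)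

/-- A row contraction `(R_i)` times a bounded column `(L_i)`: the series `∑ R_i L_i` converges
strongly and unconditionally, and its norm is at most that of the column. -/
theorem exists_hasStrongSum_row_mul_column {ι : Type*} (R L : ι → V →L[ℂ] V) {c : ℝ} (hc : 0 ≤ c)
    (hR : ∀ s : Finset ι, ∀ h, ∑ i ∈ s, ‖adjoint (R i) h‖ ^ 2 ≤ ‖h‖ ^ 2)
    (hL : ∀ s : Finset ι, ∀ v, ∑ i ∈ s, ‖L i v‖ ^ 2 ≤ c ^ 2 * ‖v‖ ^ 2) :
    ∃ T : V →L[ℂ] V, HasStrongSum (fun i => R i * L i) T ∧ ‖T‖ ≤ c := by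
  have key : ∀ (s : Finset ι) v, ‖∑ i ∈ s, R i (L i v)‖ ^ 2 ≤ ∑ i ∈ s, ‖L i v‖ ^ 2 := fun s v => by
    simpa using norm_sum_apply_sq_le s R (fun i => L i v) zero_le_one (by simpa using hR s)
  have hsum : ∀ v, Summable fun i => ‖L i v‖ ^ 2 := fun v =>
    summable_of_sum_le (fun i => by positivity) (fun s => hL s v)
  -- Cauchy criterion: by `key`, tails of the series are controlled by tails of `∑ ‖L_i v‖²`.
  have hS : ∀ v, Summable fun i => R i (L i v) := fun v => by
    rw [summable_iff_vanishing_norm]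
    intro ε hε
    obtain ⟨s, hs⟩ := summable_iff_vanishing_norm.1 (hsum v) (ε ^ 2) (by positivity)
    refine ⟨s, fun t ht => ?_⟩
    refine lt_of_pow_lt_pow_left₀ 2 hε.le ((key t v).trans_lt ?_)
    exact (le_abs_self _).trans_lt (hs t ht)
  have hbd : ∀ v, ‖∑' i, R i (L i v)‖ ≤ c * ‖v‖ := fun v => by
    refine le_of_tendsto (hS v).hasSum.norm (Filter.Eventually.of_forall fun s => ?_)
    refine le_of_sq_le_sq ?_ (by positivity)
    rw [mul_pow]
    exact (key s v).trans (hL s v)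
  let T : V →L[ℂ] V := LinearMap.mkContinuous
    { toFun := fun v => ∑' i, R i (L i v)
      map_add' := fun v w => by simp only [map_add]; exact (hS v).tsum_add (hS w)
      map_smul' := fun a v => by simp only [map_smul]; exact (hS v).tsum_const_smul a } c hbd
  exact ⟨T, fun v => (hS v).hasSum, LinearMap.mkContinuous_norm_le _ hc _⟩

end RowColumn

/-! ### Ordered products over `Fin k` -/

section ListProd

/-- An ordered product of products splits when `b_i` commutes with `a_j` for `i ≠ j`. -/
theorem List.prod_ofFn_mul_of_commute {M : Type*} [Monoid M] {k : ℕ} (a b : Fin k → M)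
    (h : ∀ i j, i ≠ j → Commute (b i) (a j)) :
    (List.ofFn fun i => a i * b i).prod = (List.ofFn a).prod * (List.ofFn b).prod := by
  induction k with
  | zero => simp
  | succ k ih =>
    simp only [List.ofFn_succ, List.prod_cons]
    rw [ih (fun i => a i.succ) (fun i => b i.succ) fun i j hij => h _ _ (by simpa using hij)]
    have : Commute (b 0) (List.ofFn fun i : Fin k => a i.succ).prod := by
      refine Commute.list_prod_right _ _ fun y hy => ?_
      obtain ⟨i, rfl⟩ := (List.mem_ofFn' _ _).1 hy
      exact h _ _ (Fin.succ_ne_zero i).symm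
    simp only [mul_assoc]
    rw [← mul_assoc (b 0), this.eq, mul_assoc]

theorem List.prod_ofFn_eq_single {M : Type*} [Monoid M] {k : ℕ} (f : Fin k → M) (j : Fin k)
    (h : ∀ i, i ≠ j → f i = 1) : (List.ofFn f).prod = f j := by
  induction k with
  | zero => exact j.elim0
  | succ k ih =>
    rw [List.ofFn_succ, List.prod_cons]
    induction j using Fin.cases with
    | zero =>
      have : (fun i : Fin k => f i.succ) = fun _ => 1 :=
        funext fun i => h _ (Fin.succ_ne_zero i)
      simp [this, List.ofFn_const]
    | succ j =>
      rw [h 0 (Fin.succ_ne_zero j).symm, one_mul]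
      exact ih _ j fun i hi => h _ (by simpa using hi)

theorem List.prod_ofFn_mulSingle {k : ℕ} {M : Fin k → Type*} [∀ i, Monoid (M i)]
    (α : (i : Fin k) → M i) : (List.ofFn fun i => Pi.mulSingle i (α i)).prod = α := by
  funext j
  change Pi.evalMonoidHom M j (List.ofFn fun i => Pi.mulSingle i (α i)).prod = _
  rw [map_list_prod, List.map_ofFn, List.prod_ofFn_eq_single _ j]
  · simp
  · intro i hi
    simp [Pi.mulSingle_eq_of_ne hi.symm]

/-- Distributivity: a product of finite sums is the sum over all choices of one summand in each
factor, in a not necessarily commutative semiring. -/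
theorem List.prod_ofFn_sum {R : Type*} [Semiring R] {k : ℕ} {ι : Fin k → Type*}
    (s : (i : Fin k) → Finset (ι i)) (f : (i : Fin k) → ι i → R) :
    (List.ofFn fun i => ∑ w ∈ s i, f i w).prod =
      ∑ γ ∈ Fintype.piFinset s, (List.ofFn fun i => f i (γ i)).prod := by
  induction k with
  | zero => simp
  | succ k ih =>
    simp only [List.ofFn_succ, List.prod_cons]
    rw [ih (fun i => s i.succ) (fun i => f i.succ), Finset.sum_mul_sum, ← Finset.sum_product']
    refine Finset.sum_bij' (fun p _ => (Fin.consEquiv ι) p) (fun γ _ => (Fin.consEquiv ι).symm γ)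
      ?_ ?_ ?_ ?_ ?_
    · rintro ⟨a, g⟩ h
      rw [Fintype.mem_piFinset]
      simp only [Finset.mem_product, Fintype.mem_piFinset] at h
      intro i
      induction i using Fin.cases with
      | zero => exact h.1
      | succ i => exact h.2 i
    · intro γ h
      simp only [Fintype.mem_piFinset] at h
      simp only [Finset.mem_product, Fintype.mem_piFinset]
      exact ⟨h 0, fun i => h i.succ⟩
    · intro p _; simp
    · intro γ _; exact (Fin.consEquiv ι).apply_symm_apply γ
    · rintro ⟨a, g⟩ _; simp

end ListProd

/-! ### Words in tuples of operators -/

section Words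

variable {k : ℕ} {n : Fin k → ℕ} {V : Type*} [NormedAddCommGroup V] [InnerProductSpace ℂ V]

theorem OpTuple.commute_lift {X : OpTuple n V}
    (hX : ∀ s t, s ≠ t → ∀ i j, Commute (X s i) (X t j)) {s t : Fin k} (hst : s ≠ t)
    (a : FreeMonoid (Fin (n s))) (b : FreeMonoid (Fin (n t))) :
    Commute (FreeMonoid.lift (X s) a) (FreeMonoid.lift (X t) b) := by
  have h1 : ∀ i, Commute (X s i) (FreeMonoid.lift (X t) b) := fun i => by
    induction b using FreeMonoid.inductionOn' with
    | one => simp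
    | of_mul j b ih => rw [map_mul, FreeMonoid.lift_eval_of]; exact (hX s t hst i j).mul_right ih
  induction a using FreeMonoid.inductionOn' with
  | one => simp
  | of_mul j a ih => rw [map_mul, FreeMonoid.lift_eval_of]; exact (h1 j).mul_left ih

theorem OpTuple.word_one (X : OpTuple n V) : X.word 1 = 1 := by
  simp [OpTuple.word, List.ofFn_const]

theorem OpTuple.word_mul {X : OpTuple n V}
    (hX : ∀ s t, s ≠ t → ∀ i j, Commute (X s i) (X t j)) (α β : PolyWord n) :
    X.word (α * β) = X.word α * X.word β := by
  simp only [OpTuple.word, Pi.mul_apply, map_mul]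
  exact List.prod_ofFn_mul_of_commute _ _ fun i j hij => OpTuple.commute_lift hX hij _ _

theorem OpTuple.continuous_word (α : PolyWord n) :
    Continuous fun X : OpTuple n V => X.word α := by
  have h : ∀ i (a : FreeMonoid (Fin (n i))),
      Continuous fun X : OpTuple n V => FreeMonoid.lift (X i) a := fun i a => by
    induction a using FreeMonoid.inductionOn' with
    | one => simpa using continuous_const
    | of_mul j a ih =>
      simp only [map_mul, FreeMonoid.lift_eval_of]
      have hj : Continuous fun X : OpTuple n V => X i j := by fun_prop
      exact hj.mul ih
  simp only [OpTuple.word, List.ofFn_eq_map]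
  exact continuous_list_prod _ fun i _ => h i (α i)

/-- The total length `|α₁| + ⋯ + |α_k|`. -/
def PolyWord.totalLength (α : PolyWord n) : ℕ := ∑ i, (α i).length

/-- A tuple that acts on a family of vectors `u_β` by `X_{i,j} u_β = c u_{g_j^i β}` satisfies
`X_α u_β = c^{|α|} u_{αβ}`. -/
theorem OpTuple.word_apply_of_shift {X : OpTuple n V} {u : PolyWord n → V} {c : ℂ}
    (h : ∀ i j β, X i j (u β) = c • u (PolyWord.gen i j * β)) (α β : PolyWord n) :
    X.word α (u β) = c ^ α.totalLength • u (α * β) := by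
  have h1 : ∀ i (a : FreeMonoid (Fin (n i))) β,
      FreeMonoid.lift (X i) a (u β) = c ^ a.length • u (Pi.mulSingle i a * β) := fun i a => by
    induction a using FreeMonoid.inductionOn' with
    | one => simp
    | of_mul j a ih =>
      intro β
      rw [map_mul, FreeMonoid.lift_eval_of, mul_apply_eq_comp, ih, map_smul, h, smul_smul,
        FreeMonoid.length_mul, FreeMonoid.length_of, Pi.mulSingle_mul, mul_assoc, pow_add, pow_one,
        mul_comm c]
      rfl
  have h2 : ∀ l : List (Fin k), ∀ β, (l.map fun i => FreeMonoid.lift (X i) (α i)).prod (u β) =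
      c ^ (l.map fun i => (α i).length).sum •
        u ((l.map fun i => Pi.mulSingle i (α i)).prod * β) := fun l => by
    induction l with
    | nil => simp
    | cons i l ih =>
      intro β
      simp only [List.map_cons, List.prod_cons, List.sum_cons, mul_apply_eq_comp]
      rw [ih, map_smul, h1, smul_smul, mul_assoc, pow_add, mul_comm]
  have h3 := h2 (List.finRange k) β
  rw [← List.ofFn_eq_map, ← List.ofFn_eq_map, ← List.ofFn_eq_map, List.prod_ofFn_mulSingle,
    List.sum_ofFn] at h3
  exact h3

theorem word_universalModel_basisVec (α β : PolyWord n) :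
    (universalModel n).word α (PolyFock.basisVec β) = PolyFock.basisVec (α * β) := by
  simpa using OpTuple.word_apply_of_shift (X := universalModel n) (u := PolyFock.basisVec) (c := 1)
    (fun i j β => by simpa [universalModel] using creation_basisVec i j β) α β

/-- Orthogonality of the ranges of `S_α` and `S_β` means that `α` and `β` have no common multiple
of the form `α σ = β τ`. -/
theorem IsOrthogonalSet.mul_ne_mul {Λ : Set (PolyWord n)} (hΛ : IsOrthogonalSet Λ)
    {α β : PolyWord n} (hα : α ∈ Λ) (hβ : β ∈ Λ) (hne : α ≠ β) (σ τ : PolyWord n) :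
    α * σ ≠ β * τ := by
  intro h
  have h1 := congrArg (fun T => inner ℂ (PolyFock.basisVec τ) (T (PolyFock.basisVec σ)))
    (hΛ α hα β hβ hne)
  simp only [mul_apply_eq_comp, adjoint_inner_right, word_universalModel_basisVec, h,
    zero_apply, inner_zero_right] at h1
  rw [inner_self_eq_norm_sq_to_K, PolyFock.orthonormal_basisVec.1] at h1
  simp at h1

end Words

/-! ### Row contractions from the regular polyball -/

section PolyballRow

variable {k : ℕ} {n : Fin k → ℕ} {V : Type*} [NormedAddCommGroup V] [InnerProductSpace ℂ V]
  [CompleteSpace V]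

/-- Conjugation `Y ↦ a Y a^*`, multiplicative in `a`. -/
noncomputable def conjEnd : (V →L[ℂ] V) →* Module.End ℂ (V →L[ℂ] V) where
  toFun a := LinearMap.mulLeftRight ℂ (a, adjoint a)
  map_one' := by
    refine LinearMap.ext fun Y => ?_
    simp [← star_eq_adjoint]
  map_mul' a b := by
    refine LinearMap.ext fun Y => ?_
    simp [← star_eq_adjoint, mul_assoc]

theorem conjEnd_apply (a Y : V →L[ℂ] V) : conjEnd a Y = a * Y * adjoint a := by
  simp [conjEnd]

theorem OpTuple.cpMap_eq_sum_conjEnd (X : OpTuple n V) (i : Fin k) :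
    X.cpMap i = ∑ j, conjEnd (X i j) := rfl

theorem OpTuple.conjEnd_word (X : OpTuple n V) (α : PolyWord n) :
    conjEnd (X.word α) =
      (List.ofFn fun i => FreeMonoid.lift (fun j => conjEnd (X i j)) (α i)).prod := by
  rw [OpTuple.word, map_list_prod, List.map_ofFn]
  congr 2
  funext i
  exact DFunLike.congr_fun (FreeMonoid.comp_lift conjEnd (X i)) (α i)

/-- In a noncommutative ring, the sum of all monomials of degree `< N` in the `c_j` is the geometric
sum of `∑ c_j`. -/
theorem sum_lift_length_lt {R : Type*} [Semiring R] {m : ℕ} (c : Fin m → R) (N : ℕ) :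
    ∑ a ∈ (List.finite_length_lt (Fin m) N).toFinset, FreeMonoid.lift c (FreeMonoid.ofList a) =
      ∑ p ∈ Finset.range N, (∑ j, c j) ^ p := by
  classical
  induction N with
  | zero => simp
  | succ N ih =>
    rw [geom_sum_succ, ← ih]
    have : (List.finite_length_lt (Fin m) (N + 1)).toFinset =
        insert [] ((Finset.univ ×ˢ (List.finite_length_lt (Fin m) N).toFinset).image
          fun p : Fin m × List (Fin m) => p.1 :: p.2) := by
      ext a
      cases a <;> simp
    rw [this, Finset.sum_insert (by simp), Finset.sum_image (by
      rintro ⟨a, l⟩ _ ⟨b, l'⟩ _ h; simpa using h), Finset.sum_product, Finset.sum_mul_sum, add_comm]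
    simp [FreeMonoid.ofList_cons]

/-- The box of all `γ` with `|γ_i| < N` for every `i`. -/
noncomputable def PolyWord.box (n : Fin k → ℕ) (N : ℕ) : Finset (PolyWord n) :=
  Fintype.piFinset fun i => ((List.finite_length_lt (Fin (n i)) N).toFinset :
    Finset (List (Fin (n i))))

theorem PolyWord.mem_box {N : ℕ} {γ : PolyWord n} :
    γ ∈ PolyWord.box n N ↔ ∀ i, (γ i).length < N := by
  refine Fintype.mem_piFinset.trans (forall_congr' fun i => ?_)
  exact Set.Finite.mem_toFinset _

theorem PolyWord.tendsto_box : Filter.Tendsto (PolyWord.box n) Filter.atTop Filter.atTop := by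
  refine Filter.tendsto_atTop_finset_of_monotone (fun N M h γ hγ => ?_) fun γ => ?_
  · rw [PolyWord.mem_box] at hγ ⊢
    exact fun i => (hγ i).trans_le h
  · refine ⟨∑ i, (γ i).length + 1, PolyWord.mem_box.2 fun i => Nat.lt_succ_of_le ?_⟩
    exact Finset.single_le_sum (f := fun i => (γ i).length) (fun _ _ => Nat.zero_le _)
      (Finset.mem_univ i)

theorem OpTuple.sum_box_conjEnd_word (X : OpTuple n V) (N : ℕ) :
    ∑ γ ∈ PolyWord.box n N, conjEnd (X.word γ) =
      (List.ofFn fun i => ∑ p ∈ Finset.range N, X.cpMap i ^ p).prod := by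
  simp_rw [OpTuple.conjEnd_word, OpTuple.cpMap_eq_sum_conjEnd, ← sum_lift_length_lt]
  rw [List.prod_ofFn_sum]
  rfl

theorem OpTuple.commute_cpMap {X : OpTuple n V}
    (hX : ∀ s t, s ≠ t → ∀ i j, Commute (X s i) (X t j)) {s t : Fin k} (hst : s ≠ t) :
    Commute (X.cpMap s) (X.cpMap t) := by
  rw [OpTuple.cpMap_eq_sum_conjEnd, OpTuple.cpMap_eq_sum_conjEnd]
  exact Commute.sum_left _ _ _ fun i _ => Commute.sum_right _ _ _ fun j _ =>
    (hX s t hst i j).map conjEnd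

/-- Telescoping of `∏ (∑_{p<N} Φ_i^p) ∏ (1 - Φ_i) = ∏ (1 - Φ_i^N)`, applied to the identity. -/
theorem OpTuple.sum_box_conjEnd_word_defect {X : OpTuple n V}
    (hX : ∀ s t, s ≠ t → ∀ i j, Commute (X s i) (X t j)) (N : ℕ) :
    ∑ γ ∈ PolyWord.box n N, X.word γ * X.defectMap 1 * adjoint (X.word γ) =
      (List.ofFn fun i => 1 - X.cpMap i ^ N).prod 1 := by
  have h1 : (List.ofFn fun i => ∑ p ∈ Finset.range N, X.cpMap i ^ p).prod * X.defectMap =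
      (List.ofFn fun i => 1 - X.cpMap i ^ N).prod := by
    rw [OpTuple.defectMap, ← List.prod_ofFn_mul_of_commute]
    · simp_rw [geom_sum_mul_neg]
    · intro i j hij
      refine Commute.sum_right _ _ _ fun p _ => Commute.pow_right ?_ p
      exact (Commute.one_left _).sub_left (OpTuple.commute_cpMap hX hij)
  rw [← h1, ← OpTuple.sum_box_conjEnd_word, Module.End.mul_apply, LinearMap.sum_apply]
  simp_rw [conjEnd_apply]

theorem OpTuple.norm_cpMap_apply_le (X : OpTuple n V) (i : Fin k) (Y : V →L[ℂ] V) :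
    ‖X.cpMap i Y‖ ≤ ‖∑ j, X i j * adjoint (X i j)‖ * ‖Y‖ := by
  set c := ‖∑ j, X i j * adjoint (X i j)‖ with hc
  have hc0 : 0 ≤ c := norm_nonneg _
  have hR : ∀ h, ∑ j, ‖adjoint (X i j) h‖ ^ 2 ≤ c * ‖h‖ ^ 2 := fun h => by
    simpa only [adjoint_adjoint] using
      sum_norm_sq_le_norm_mul Finset.univ (fun j => adjoint (X i j)) h
  refine opNorm_le_bound _ (by positivity) fun h => le_of_sq_le_sq ?_ (by positivity)
  have h1 := norm_sum_apply_sq_le Finset.univ (X i) (fun j => Y (adjoint (X i j) h)) hc0 hR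
  calc ‖X.cpMap i Y h‖ ^ 2 = ‖∑ j, X i j (Y (adjoint (X i j) h))‖ ^ 2 := by
        simp [OpTuple.cpMap_apply, sum_apply]
    _ ≤ c * ∑ j, ‖Y (adjoint (X i j) h)‖ ^ 2 := h1
    _ ≤ c * ∑ j, ‖Y‖ ^ 2 * ‖adjoint (X i j) h‖ ^ 2 := by
        gcongr with j
        rw [← mul_pow]
        gcongr
        exact le_opNorm _ _
    _ = c * ‖Y‖ ^ 2 * ∑ j, ‖adjoint (X i j) h‖ ^ 2 := by rw [← Finset.mul_sum, mul_assoc]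
    _ ≤ c * ‖Y‖ ^ 2 * (c * ‖h‖ ^ 2) := by gcongr; exact hR h
    _ = _ := by ring

theorem OpTuple.norm_cpMap_pow_apply_le (X : OpTuple n V) (i : Fin k) (N : ℕ) (Y : V →L[ℂ] V) :
    ‖(X.cpMap i ^ N) Y‖ ≤ ‖∑ j, X i j * adjoint (X i j)‖ ^ N * ‖Y‖ := by
  induction N with
  | zero => simp
  | succ N ih =>
    rw [pow_succ', Module.End.mul_apply, pow_succ', mul_assoc]
    exact (X.norm_cpMap_apply_le i _).trans (by gcongr)

theorem norm_lt_one_of_mem_regularPolyball {X : OpTuple n V} (hX : X ∈ regularPolyball n V)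
    (i : Fin k) : ‖∑ j, X i j * adjoint (X i j)‖ < 1 := by
  by_contra h
  exact absurd (hX.2.1 i) (not_lt.2 (Real.one_le_rpow (not_lt.1 h) (by norm_num)))

theorem OpTuple.tendsto_prod_one_sub_pow {X : OpTuple n V} (hX : X ∈ regularPolyball n V) :
    Filter.Tendsto (fun N => ((List.ofFn fun i => 1 - X.cpMap i ^ N).prod :
      Module.End ℂ (V →L[ℂ] V)) 1)
      Filter.atTop (nhds 1) := by
  simp_rw [List.ofFn_eq_map]
  induction List.finRange k with
  | nil => simp
  | cons i l ih =>
    simp only [List.map_cons, List.prod_cons, Module.End.mul_apply, LinearMap.sub_apply,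
      Module.End.one_apply]
    have h0 : Filter.Tendsto (fun N => (X.cpMap i ^ N)
        (((l.map fun i => 1 - X.cpMap i ^ N).prod : Module.End ℂ (V →L[ℂ] V)) 1))
        Filter.atTop (nhds 0) := by
      refine squeeze_zero_norm (fun N => X.norm_cpMap_pow_apply_le i N _) ?_
      simpa using (tendsto_pow_atTop_nhds_zero_of_lt_one (norm_nonneg _)
        (norm_lt_one_of_mem_regularPolyball hX i)).mul ih.norm
    simpa using ih.sub h0

/-- The Poisson kernel of a tuple in the regular polyball is an isometry:
`∑_γ ⟪Δ X_γ^* h, X_γ^* h⟫ = ‖h‖²`, where `Δ` is the defect operator. -/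
theorem hasSum_inner_defect {X : OpTuple n V} (hX : X ∈ regularPolyball n V) (h : V) :
    HasSum (fun γ => (inner ℂ (X.defectMap 1 (adjoint (X.word γ) h)) (adjoint (X.word γ) h)).re)
      (‖h‖ ^ 2) := by
  set q : PolyWord n → ℝ := fun γ =>
    (inner ℂ (X.defectMap 1 (adjoint (X.word γ) h)) (adjoint (X.word γ) h)).re with hq
  have hq0 : ∀ γ, 0 ≤ q γ := fun γ =>
    ((ContinuousLinearMap.nonneg_iff_isPositive _).1 hX.2.2.1).re_inner_nonneg_left _
  have hbox : ∀ N, ∑ γ ∈ PolyWord.box n N, q γ =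
      (inner ℂ ((List.ofFn fun i => 1 - X.cpMap i ^ N).prod (1 : V →L[ℂ] V) h) h).re := fun N => by
    rw [← OpTuple.sum_box_conjEnd_word_defect hX.1]
    simp [q, sum_apply, ← adjoint_inner_right]
  have hlim : Filter.Tendsto (fun N => ∑ γ ∈ PolyWord.box n N, q γ) Filter.atTop
      (nhds (‖h‖ ^ 2)) := by
    simp_rw [hbox]
    have hcont : Continuous fun Y : V →L[ℂ] V => (inner ℂ (Y h) h).re := by fun_prop
    have := (hcont.tendsto 1).comp (OpTuple.tendsto_prod_one_sub_pow hX)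
    rw [← inner_self_eq_norm_sq (𝕜 := ℂ) h]
    exact this
  have hs : Summable q := summable_of_sum_le hq0 fun s =>
    ge_of_tendsto hlim ((PolyWord.tendsto_box.eventually_ge_atTop s).mono fun N hN =>
      Finset.sum_le_sum_of_subset_of_nonneg hN fun γ _ _ => hq0 γ)
  rw [← tendsto_nhds_unique (hs.hasSum.comp PolyWord.tendsto_box) hlim]
  exact hs.hasSum

/-- If `Λ` is orthogonal, `[X_α : α ∈ Λ]` is a row contraction for every `X` in the regular
polyball: the sets `α W`, `α ∈ Λ`, are disjoint, and `‖X_α^* h‖²` is the part of the sum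
`∑_γ ⟪Δ X_γ^* h, X_γ^* h⟫ = ‖h‖²` over `γ ∈ α W`. -/
theorem sum_norm_adjoint_word_sq_le {X : OpTuple n V} (hX : X ∈ regularPolyball n V)
    {Λ : Set (PolyWord n)} (hΛ : IsOrthogonalSet Λ) (s : Finset Λ) (h : V) :
    ∑ α ∈ s, ‖adjoint (X.word α) h‖ ^ 2 ≤ ‖h‖ ^ 2 := by
  set q : PolyWord n → ℝ := fun γ =>
    (inner ℂ (X.defectMap 1 (adjoint (X.word γ) h)) (adjoint (X.word γ) h)).re with hq
  have hq0 : ∀ γ, 0 ≤ q γ := fun γ =>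
    ((ContinuousLinearMap.nonneg_iff_isPositive _).1 hX.2.2.1).re_inner_nonneg_left _
  -- The Poisson identity for the vector `X_α^* h`, with `X_α X_β = X_{αβ}`.
  have h1 : ∀ α, HasSum (fun β => q (α * β)) (‖adjoint (X.word α) h‖ ^ 2) := fun α => by
    have h2 := hasSum_inner_defect hX (adjoint (X.word α) h)
    have h3 : ∀ β, adjoint (X.word β) (adjoint (X.word α) h) = adjoint (X.word (α * β)) h :=
      fun β => by simp only [OpTuple.word_mul hX.1, ← star_eq_adjoint, star_mul, mul_apply_eq_comp]
    simpa only [h3] using h2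
  refine hasSum_le_of_sum_le (hasSum_sum (s := s) fun α _ => h1 α) fun t => ?_
  have hinj : Set.InjOn (fun p : PolyWord n × Λ => (p.2 : PolyWord n) * p.1) (t ×ˢ s : Finset _) := by
    rintro ⟨β, α⟩ _ ⟨β', α'⟩ _ he
    have hα : α = α' := by
      by_contra hne
      exact hΛ.mul_ne_mul α.2 α'.2 (fun h => hne (Subtype.ext h)) β β' he
    subst hα
    exact Prod.ext (mul_left_cancel he) rfl
  classical
  rw [← Finset.sum_product', ← Finset.sum_image (f := q) hinj]
  exact sum_le_hasSum _ (fun γ _ => hq0 γ) (hasSum_inner_defect hX h)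

theorem sum_norm_adjoint_word_sq_le_of_mem_closure {X : OpTuple n V}
    (hX : X ∈ closure (regularPolyball n V))
    {Λ : Set (PolyWord n)} (hΛ : IsOrthogonalSet Λ) (s : Finset Λ) (h : V) :
    ∑ α ∈ s, ‖adjoint (X.word α) h‖ ^ 2 ≤ ‖h‖ ^ 2 := by
  refine closure_minimal (s := regularPolyball n V)
    (t := {X | ∑ α ∈ s, ‖adjoint (X.word α) h‖ ^ 2 ≤ ‖h‖ ^ 2})
    (fun Y hY => sum_norm_adjoint_word_sq_le hY hΛ s h) ?_ hX
  refine isClosed_le (continuous_finsetSum _ fun α _ => ?_) continuous_const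
  have h1 : Continuous fun Y : OpTuple n V => adjoint (Y.word α) :=
    (adjoint (𝕜 := ℂ) (E := V) (F := V)).continuous.comp (OpTuple.continuous_word _)
  exact ((h1.clm_apply continuous_const).norm).pow 2

end PolyballRow

/-! ### Relations in the universal model -/

section Model

variable {k : ℕ} {n : Fin k → ℕ}

theorem PolyFock.ext_op {W : Type*} [NormedAddCommGroup W] [NormedSpace ℂ W]
    {S T : PolyFock n →L[ℂ] W} (h : ∀ β, S (basisVec β) = T (basisVec β)) : S = T := by
  classical
  refine lp.ext_continuousLinearMap (by norm_num) fun β => ?_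
  refine ContinuousLinearMap.ext_ring ?_
  simp only [comp_apply, lp.singleContinuousLinearMap_apply]
  convert h β <;> rw [basisVec]

theorem PolyFock.inner_basisVec (α : PolyWord n) (f : PolyFock n) :
    inner ℂ (basisVec α) f = f α := by
  classical
  rw [basisVec, lp.inner_single_left]
  simp

theorem adjoint_creation_basisVec_gen_mul (i : Fin k) (j : Fin (n i)) (β : PolyWord n) :
    adjoint (creation i j) (PolyFock.basisVec (PolyWord.gen i j * β)) = PolyFock.basisVec β := by
  classical
  ext ω
  rw [← PolyFock.inner_basisVec, ← PolyFock.inner_basisVec, adjoint_inner_right,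
    creation_basisVec, orthonormal_iff_ite.1 PolyFock.orthonormal_basisVec,
    orthonormal_iff_ite.1 PolyFock.orthonormal_basisVec]
  simp

theorem adjoint_creation_basisVec_eq_zero {i : Fin k} {j : Fin (n i)} {γ : PolyWord n}
    (h : ∀ β, PolyWord.gen i j * β ≠ γ) : adjoint (creation i j) (PolyFock.basisVec γ) = 0 := by
  classical
  ext ω
  rw [← PolyFock.inner_basisVec, adjoint_inner_right, creation_basisVec,
    orthonormal_iff_ite.1 PolyFock.orthonormal_basisVec, if_neg (h ω)]
  rfl

theorem adjoint_creation_mul_creation_self (i : Fin k) (j : Fin (n i)) :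
    adjoint (creation i j) * creation i j = 1 :=
  PolyFock.ext_op fun β => by
    rw [mul_apply_eq_comp, creation_basisVec, adjoint_creation_basisVec_gen_mul]; rfl

theorem PolyWord.gen_commute {s t : Fin k} (hst : s ≠ t) (i : Fin (n s)) (j : Fin (n t)) :
    Commute (PolyWord.gen s i : PolyWord n) (PolyWord.gen t j) :=
  Pi.mulSingle_commute hst _ _

theorem adjoint_creation_mul_creation_of_ne (i : Fin k) {j j' : Fin (n i)} (h : j ≠ j') :
    adjoint (creation i j) * creation i j' = 0 :=
  PolyFock.ext_op fun β => by
    rw [mul_apply_eq_comp, creation_basisVec, adjoint_creation_basisVec_eq_zero]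
    · rfl
    · intro σ hσ
      have h1 := congrFun hσ i
      simp only [PolyWord.gen, Pi.mul_apply, Pi.mulSingle_eq_same] at h1
      exact h (List.cons.inj h1).1

theorem commute_creation {s t : Fin k} (hst : s ≠ t) (i : Fin (n s)) (j : Fin (n t)) :
    Commute (creation s i) (creation t j) :=
  PolyFock.ext_op fun β => by
    simp only [mul_apply_eq_comp, creation_basisVec, ← mul_assoc, (PolyWord.gen_commute hst i j).eq]

/-- Creation operators of different factors doubly commute: outside the range of `S_{t,j}` both
products vanish on basis vectors. -/
theorem commute_creation_adjoint {s t : Fin k} (hst : s ≠ t) (i : Fin (n s)) (j : Fin (n t)) :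
    Commute (creation s i) (adjoint (creation t j)) :=
  PolyFock.ext_op fun β => by
    simp only [mul_apply_eq_comp, creation_basisVec]
    by_cases h : ∃ β', PolyWord.gen t j * β' = β
    · obtain ⟨β', rfl⟩ := h
      rw [adjoint_creation_basisVec_gen_mul, creation_basisVec, ← mul_assoc,
        (PolyWord.gen_commute hst i j).eq, mul_assoc, adjoint_creation_basisVec_gen_mul]
    · rw [not_exists] at h
      rw [adjoint_creation_basisVec_eq_zero h, map_zero, adjoint_creation_basisVec_eq_zero]
      intro σ hσ
      refine h (Function.update β t (σ t)) (funext fun l => ?_)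
      have h1 := congrFun hσ t
      simp only [PolyWord.gen, Pi.mul_apply, Pi.mulSingle_eq_same,
        Pi.mulSingle_eq_of_ne hst.symm, one_mul] at h1
      by_cases hl : l = t
      · subst hl
        simpa [PolyWord.gen] using h1
      · simp [PolyWord.gen, hl]

theorem isStarProjection_sum_creation (i : Fin k) :
    IsStarProjection (∑ j : Fin (n i), creation i j * adjoint (creation i j)) := by
  constructor
  · rw [IsIdempotentElem, Finset.sum_mul_sum]
    refine Finset.sum_congr rfl fun j _ => ?_
    rw [Finset.sum_eq_single j]
    · rw [mul_assoc, ← mul_assoc (adjoint _), adjoint_creation_mul_creation_self, one_mul]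
    · intro j' _ hj
      rw [mul_assoc, ← mul_assoc (adjoint _), adjoint_creation_mul_creation_of_ne i hj.symm,
        zero_mul, mul_zero]
    · simp
  · exact isSelfAdjoint_sum _ fun j _ => IsSelfAdjoint.mul_star_self _

end Model

/-! ### Copies of the universal model in the polyball -/

section DoublyCommuting

variable {k : ℕ} {n : Fin k → ℕ} {V : Type*} [NormedAddCommGroup V] [InnerProductSpace ℂ V]
  [CompleteSpace V]

/-- For doubly commuting tuples the defect operator factors as `∏ (I - Φ_{X_i}(I))`, so that it is
positive and invertible as soon as each `X_i` is a strict row contraction. -/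
theorem mem_regularPolyball_of_doublyCommuting {X : OpTuple n V}
    (hX : ∀ s t, s ≠ t → ∀ i j, Commute (X s i) (X t j))
    (hX' : ∀ s t, s ≠ t → ∀ i j, Commute (X s i) (adjoint (X t j)))
    (h1 : ∀ i, ‖∑ j, X i j * adjoint (X i j)‖ < 1) : X ∈ regularPolyball n V := by
  set P : Fin k → V →L[ℂ] V := fun i => ∑ j, X i j * adjoint (X i j) with hP
  have hP0 : ∀ i, 0 ≤ P i := fun i => Finset.sum_nonneg fun j _ => mul_star_self_nonneg (X i j)
  have hXP : ∀ s t, s ≠ t → ∀ i, Commute (adjoint (X s i)) (P t) := fun s t hst i =>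
    Commute.sum_right _ _ _ fun j _ => by
      refine Commute.mul_right (hX' t s hst.symm j i).symm ?_
      have := (hX s t hst i j).star_star
      exact this
  have hPP : ∀ s t, Commute (1 - P s) (1 - P t) := fun s t => by
    rcases eq_or_ne s t with rfl | hst
    · exact Commute.refl _
    · refine (Commute.one_left _).sub_left (Commute.sub_right (Commute.one_right _) ?_)
      refine Commute.sum_left _ _ _ fun j _ => Commute.mul_left ?_ (hXP s t hst j)
      exact Commute.sum_right _ _ _ fun j' _ => (hX s t hst j j').mul_right (hX' s t hst j j')
  -- `Φ_{X_i}(Y) = Φ_{X_i}(I) Y` when `Y` commutes with the adjoints of the entries of `X_i`.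
  have hdef : ∀ l : List (Fin k), l.Nodup →
      ((l.map fun i => 1 - X.cpMap i).prod : Module.End ℂ (V →L[ℂ] V)) 1 =
        (l.map fun i => 1 - P i).prod := fun l hl => by
    induction l with
    | nil => simp
    | cons i l ih =>
      rw [List.nodup_cons] at hl
      simp only [List.map_cons, List.prod_cons, Module.End.mul_apply, LinearMap.sub_apply,
        Module.End.one_apply, ih hl.2, OpTuple.cpMap_apply]
      rw [sub_mul, one_mul, hP, Finset.sum_mul]
      congr 1
      refine Finset.sum_congr rfl fun j _ => ?_
      rw [mul_assoc, mul_assoc]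
      congr 1
      refine (Commute.list_prod_right _ _ fun y hy => ?_ : Commute (adjoint (X i j)) _).symm
      obtain ⟨t, ht, rfl⟩ := List.mem_map.1 hy
      exact (Commute.one_right _).sub_right (hXP i t (fun h => hl.1 (h ▸ ht)) j)
  have hprod : ∀ l : List (Fin k), 0 ≤ (l.map fun i => 1 - P i).prod ∧
      IsUnit (l.map fun i => 1 - P i).prod := fun l => by
    induction l with
    | nil => simp
    | cons i l ih =>
      rw [List.map_cons, List.prod_cons]
      refine ⟨Commute.mul_nonneg ?_ ih.1 ?_, (isUnit_one_sub_of_norm_lt_one (h1 i)).mul ih.2⟩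
      · exact sub_nonneg.2 ((CStarAlgebra.norm_le_one_iff_of_nonneg _ (hP0 i)).1 (h1 i).le)
      · refine Commute.list_prod_right _ _ fun y hy => ?_
        obtain ⟨t, ht, rfl⟩ := List.mem_map.1 hy
        exact hPP i t
  refine ⟨hX, fun i => Real.rpow_lt_one (norm_nonneg _) (h1 i) (by norm_num), ?_⟩
  rw [OpTuple.defectMap, List.ofFn_eq_map, hdef _ (List.nodup_finRange k)]
  exact hprod _

/-- The copy `r J S J^*` of the scaled universal model along an isometry `J` of the Fock space. -/
noncomputable def scaledModel (J : PolyFock n →ₗᵢ[ℂ] V) (r : ℝ) : OpTuple n V := fun i j =>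
  (r : ℂ) • (J.toContinuousLinearMap ∘L creation i j ∘L adjoint J.toContinuousLinearMap)

theorem adjoint_comp_self_of_isometry (J : PolyFock n →ₗᵢ[ℂ] V) (f : PolyFock n) :
    adjoint J.toContinuousLinearMap (J f) = f :=
  DFunLike.congr_fun ((norm_map_iff_adjoint_comp_self J.toContinuousLinearMap).1 J.norm_map) f

theorem scaledModel_apply (J : PolyFock n →ₗᵢ[ℂ] V) (r : ℝ) (i : Fin k) (j : Fin (n i))
    (β : PolyWord n) : scaledModel J r i j (J (PolyFock.basisVec β)) =
      (r : ℂ) • J (PolyFock.basisVec (PolyWord.gen i j * β)) := by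
  simp [scaledModel, adjoint_comp_self_of_isometry, creation_basisVec]

theorem scaledModel_mem_regularPolyball (J : PolyFock n →ₗᵢ[ℂ] V) {r : ℝ} (h0 : 0 ≤ r)
    (h1 : r < 1) : scaledModel J r ∈ regularPolyball n V := by
  set j := J.toContinuousLinearMap with hj
  have hjj : ∀ A B : PolyFock n →L[ℂ] PolyFock n, (j ∘L A ∘L adjoint j) * (j ∘L B ∘L adjoint j) =
      j ∘L (A * B) ∘L adjoint j := fun A B => by
    ext v
    simp [hj, adjoint_comp_self_of_isometry]
  have hadj : ∀ s i, adjoint (scaledModel J r s i) =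
      (r : ℂ) • (j ∘L adjoint (creation s i) ∘L adjoint j) := fun s i => by
    rw [scaledModel, map_smulₛₗ, Complex.conj_ofReal, adjoint_comp, adjoint_comp,
      adjoint_adjoint, comp_assoc]
  refine mem_regularPolyball_of_doublyCommuting (fun s t hst i i' => ?_) (fun s t hst i i' => ?_)
    fun i => ?_
  · refine Commute.smul_left (Commute.smul_right ?_ _) _
    rw [Commute, SemiconjBy, hjj, hjj, (commute_creation hst i i').eq]
  · rw [hadj]
    refine Commute.smul_left (Commute.smul_right ?_ _) _
    rw [Commute, SemiconjBy, hjj, hjj, (commute_creation_adjoint hst i i').eq]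
  · have hsum : ∑ i', scaledModel J r i i' * adjoint (scaledModel J r i i') =
        ((r : ℂ) * r) • (j ∘L (∑ i', creation i i' * adjoint (creation i i')) ∘L adjoint j) := by
      ext v
      simp only [hadj, sum_apply, smul_apply, comp_apply, map_sum, Finset.smul_sum,
        mul_apply_eq_comp]
      refine Finset.sum_congr rfl fun i' _ => ?_
      simp only [scaledModel, hj, smul_apply, comp_apply, map_smul, smul_smul,
        LinearIsometry.coe_toContinuousLinearMap, adjoint_comp_self_of_isometry]
    have hjn : ‖j‖ ≤ 1 := J.norm_toContinuousLinearMap_le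
    have hjn' : ‖adjoint j‖ ≤ 1 := by rwa [LinearIsometryEquiv.norm_map]
    rw [hsum, norm_smul, norm_mul, Complex.norm_real, Real.norm_of_nonneg h0]
    calc r * r * ‖j ∘L (∑ i', creation i i' * adjoint (creation i i')) ∘L adjoint j‖
        ≤ r * r * 1 := by
          gcongr
          refine (opNorm_comp_le _ _).trans (mul_le_one₀ hjn (norm_nonneg _) ?_)
          exact (opNorm_comp_le _ _).trans (mul_le_one₀
            ((isStarProjection_sum_creation i).norm_le) (norm_nonneg _) hjn')
      _ < 1 := by nlinarith

/-- The universal model is the limit of `r S`, `r → 1`. -/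
theorem universalModel_mem_closure :
    universalModel n ∈ closure (regularPolyball n (PolyFock n)) := by
  have hmem : ∀ r ∈ Set.Ico (0 : ℝ) 1,
      scaledModel LinearIsometry.id r ∈ regularPolyball n (PolyFock n) := fun r hr =>
    scaledModel_mem_regularPolyball _ hr.1 hr.2
  have h1 : scaledModel (n := n) LinearIsometry.id 1 = universalModel n := by
    funext i j
    refine PolyFock.ext_op fun β => ?_
    have := scaledModel_apply (n := n) LinearIsometry.id 1 i j β
    simpa [universalModel, creation_basisVec] using this
  have hcont : Continuous fun r : ℝ =>
      (scaledModel LinearIsometry.id r : OpTuple n (PolyFock n)) := by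
    refine continuous_pi fun i => continuous_pi fun j => ?_
    exact Complex.continuous_ofReal.smul continuous_const
  rw [← h1]
  refine hcont.continuousWithinAt.mem_closure (s := Set.Ico 0 1) ?_ hmem
  rw [closure_Ico (by norm_num)]
  simp

/-- An infinite-dimensional Hilbert space contains a copy of the Fock space. -/
theorem exists_isometry_of_infinite (hV : ¬ FiniteDimensional ℂ V) :
    Nonempty (PolyFock n →ₗᵢ[ℂ] V) := by
  classical
  obtain ⟨w, b, -⟩ := exists_hilbertBasis ℂ V
  have hw : Infinite w := by
    by_contra h
    rw [not_infinite_iff_finite] at h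
    have := Fintype.ofFinite w
    exact hV b.toOrthonormalBasis.toBasis.finiteDimensional_of_finite
  have : Countable (PolyWord n) :=
    @instCountableForallOfFinite _ _ _ fun i => inferInstanceAs (Countable (List (Fin (n i))))
  obtain ⟨f, hf⟩ := Countable.exists_injective_nat (PolyWord n)
  exact ⟨((b.orthonormal.comp (fun α => Infinite.natEmbedding w (f α))
    ((Infinite.natEmbedding w).injective.comp hf)).orthogonalFamily).linearIsometry⟩

end DoublyCommuting

/-! ### Coefficient estimates for free holomorphic functions -/

section Coefficients

variable {k : ℕ} {n : Fin k → ℕ}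
  {K : Type v} [NormedAddCommGroup K] [InnerProductSpace ℂ K]
  {H : Type u} [NormedAddCommGroup H] [InnerProductSpace ℂ H]
  {A : PolyWord n → K →L[ℂ] K}

theorem PolyWord.mem_ofMultiDegree {p : Fin k → ℕ} {α : PolyWord n} :
    α ∈ PolyWord.ofMultiDegree n p ↔ ∀ i, (α i).length = p i :=
  Set.Finite.mem_toFinset _

theorem freeEval_zero : freeEval A (0 : OpTuple n H) = opTensor (A 1) 1 := by
  have h0 : ∀ α : PolyWord n, α ≠ 1 → (0 : OpTuple n H).word α = 0 := fun α hα => by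
    obtain ⟨i, hi⟩ := Function.ne_iff.1 hα
    have h : ∀ a : FreeMonoid (Fin (n i)), a ≠ 1 → FreeMonoid.lift ((0 : OpTuple n H) i) a = 0 :=
      fun a ha => by
        cases a using FreeMonoid.casesOn with
        | one => exact absurd rfl ha
        | of_mul j a => rw [map_mul, FreeMonoid.lift_eval_of]; simp
    exact List.prod_eq_zero ((List.mem_ofFn' _ _).2 ⟨i, h _ hi⟩)
  rw [freeEval, tsum_eq_single 0]
  · rw [homogeneousPart, Finset.sum_eq_single 1, OpTuple.word_one]
    · intro α _ hα
      rw [h0 α hα, opTensor_zero_right]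
    · intro h
      exact absurd (PolyWord.mem_ofMultiDegree.2 fun i => by simp) h
  · intro p hp
    refine Finset.sum_eq_zero fun α hα => ?_
    rw [h0 α, opTensor_zero_right]
    rintro rfl
    exact hp (funext fun i => by simpa using (PolyWord.mem_ofMultiDegree.1 hα i).symm)

theorem coeff_one_nonneg [Nontrivial H] (hF0 : 0 ≤ freeEval A (0 : OpTuple n H)) : 0 ≤ A 1 := by
  rw [freeEval_zero] at hF0
  obtain ⟨u, hu⟩ := exists_norm_eq H zero_le_one
  rw [ContinuousLinearMap.nonneg_iff_isPositive, isPositive_iff_complex]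
  intro x
  have h := ((ContinuousLinearMap.nonneg_iff_isPositive _).1 hF0).inner_nonneg_left
    (hilbertTmul x u)
  have hu' : inner ℂ u u = 1 := by rw [inner_self_eq_norm_sq_to_K, hu]; simp
  rw [opTensor_hilbertTmul, inner_hilbertTmul, one_apply_eq_self, hu', mul_one] at h
  exact (RCLike.nonneg_iff_exists_ofReal.1 h).elim fun r hr => by
    rw [← hr.2]
    exact ⟨by simp, by simpa using hr.1⟩

variable [CompleteSpace H]

theorem hasSum_inner_homogeneousPart (hF : IsFreeHolomorphic.{u, v} A) {X : OpTuple n H}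
    (hX : X ∈ regularPolyball n H) (w v : HilbertTensor K H) :
    HasSum (fun p => inner ℂ w (homogeneousPart A X p v)) (inner ℂ w (freeEval A X v)) :=
  (innerSL ℂ w ∘L ContinuousLinearMap.apply ℂ (HilbertTensor K H) v).hasSum (hF H X hX).hasSum

theorem inner_homogeneousPart_scaledModel (J : PolyFock n →ₗᵢ[ℂ] H) (r : ℝ) (p : Fin k → ℕ)
    (z z' : K) (β ω : PolyWord n) :
    inner ℂ (hilbertTmul z' (J (PolyFock.basisVec ω)))
      (homogeneousPart A (scaledModel J r) p (hilbertTmul z (J (PolyFock.basisVec β)))) =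
    ∑ α ∈ PolyWord.ofMultiDegree n p, inner ℂ z' (A α z) * ((r : ℂ) ^ α.totalLength *
      inner ℂ (PolyFock.basisVec ω) (PolyFock.basisVec (α * β) : PolyFock n)) := by
  simp only [homogeneousPart, sum_apply, inner_sum, opTensor_hilbertTmul, inner_hilbertTmul]
  refine Finset.sum_congr rfl fun α _ => ?_
  rw [OpTuple.word_apply_of_shift (u := fun β => J (PolyFock.basisVec β))
    (scaledModel_apply J r) α β, inner_smul_right, LinearIsometry.inner_map_map]

/-- The matrix entry of `F(r S)` from `e_β` to `e_{γβ}` is `r^{|γ|} A_γ`. -/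
theorem inner_freeEval_scaledModel_mul (hF : IsFreeHolomorphic.{u, v} A)
    (J : PolyFock n →ₗᵢ[ℂ] H) {r : ℝ} (h0 : 0 ≤ r) (h1 : r < 1) (z z' : K) (β γ : PolyWord n) :
    inner ℂ (hilbertTmul z' (J (PolyFock.basisVec (γ * β))))
      (freeEval A (scaledModel J r) (hilbertTmul z (J (PolyFock.basisVec β)))) =
    inner ℂ z' (A γ z) * (r : ℂ) ^ γ.totalLength := by
  classical
  have h := hasSum_inner_homogeneousPart hF (scaledModel_mem_regularPolyball J h0 h1)
    (hilbertTmul z' (J (PolyFock.basisVec (γ * β)))) (hilbertTmul z (J (PolyFock.basisVec β)))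
  simp only [inner_homogeneousPart_scaledModel,
    orthonormal_iff_ite.1 PolyFock.orthonormal_basisVec, mul_left_inj] at h
  refine h.unique ?_
  convert hasSum_single (fun i => (γ i).length) fun p hp => ?_ using 1
  · rw [Finset.sum_eq_single γ]
    · simp
    · intro α _ hα
      simp [hα.symm]
    · intro hγ
      exact absurd (PolyWord.mem_ofMultiDegree.2 fun i => rfl) hγ
  · refine Finset.sum_eq_zero fun α hα => ?_
    rw [if_neg, mul_zero, mul_zero]
    rintro rfl
    exact hp (funext fun i => (PolyWord.mem_ofMultiDegree.1 hα i).symm)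

theorem inner_freeEval_scaledModel_eq_zero (hF : IsFreeHolomorphic.{u, v} A)
    (J : PolyFock n →ₗᵢ[ℂ] H) {r : ℝ} (h0 : 0 ≤ r) (h1 : r < 1) (z z' : K) {β ω : PolyWord n}
    (hne : ∀ γ, γ * β ≠ ω) :
    inner ℂ (hilbertTmul z' (J (PolyFock.basisVec ω)))
      (freeEval A (scaledModel J r) (hilbertTmul z (J (PolyFock.basisVec β)))) = 0 := by
  classical
  have h := hasSum_inner_homogeneousPart hF (scaledModel_mem_regularPolyball J h0 h1)
    (hilbertTmul z' (J (PolyFock.basisVec ω))) (hilbertTmul z (J (PolyFock.basisVec β)))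
  simp only [inner_homogeneousPart_scaledModel,
    orthonormal_iff_ite.1 PolyFock.orthonormal_basisVec, (hne _).symm, if_false, mul_zero,
    Finset.sum_const_zero] at h
  exact h.unique hasSum_zero

theorem re_inner_le_of_realPart_le {V : Type*} [NormedAddCommGroup V] [InnerProductSpace ℂ V]
    [CompleteSpace V] {T : V →L[ℂ] V} (h : (realPart T : V →L[ℂ] V) ≤ 1) (v : V) :
    (inner ℂ v (T v)).re ≤ ‖v‖ ^ 2 := by
  have h1 := ((ContinuousLinearMap.le_def _ _).1 h).re_inner_nonneg_right v
  rw [realPart_apply_coe] at h1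
  have h2 : (inner ℂ v (star T v)).re = (inner ℂ v (T v)).re := by
    rw [star_eq_adjoint, adjoint_inner_right, ← inner_conj_symm, Complex.conj_re]
  have h3 : (inner ℂ v v).re = ‖v‖ ^ 2 := inner_self_eq_norm_sq (𝕜 := ℂ) v
  simp only [sub_apply, one_apply_eq_self, inner_sub_right, smul_apply, add_apply] at h1
  rw [← Complex.coe_smul, inner_smul_right, inner_add_right] at h1
  simp only [RCLike.re_eq_complex_re, Complex.sub_re, Complex.re_ofReal_mul, Complex.add_re, h2,
    h3] at h1
  linarith

/-- Positivity of `I - Re F(r S)` compressed to `e_1` and the `e_α`, `α ∈ s`, in the limit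
`r → 1`. As `s` is an antichain for right divisibility, the only off-diagonal entries of the
compression are those in its first row and column, built from the coefficients `A_α`. -/
theorem re_sum_inner_coeff_le (hH : ¬ FiniteDimensional ℂ H) (hF : IsFreeHolomorphic.{u, v} A)
    (hRe : ∀ X ∈ regularPolyball n H,
      (realPart (freeEval A X) : HilbertTensor K H →L[ℂ] HilbertTensor K H) ≤ 1)
    (s : Finset (PolyWord n)) (hs : ∀ ω ∈ s, ∀ γ ∈ s, ω.RightLE γ → ω = γ) (hs1 : 1 ∉ s)
    (x : K) (y : PolyWord n → K) :
    ∑ α ∈ s, (inner ℂ (y α) (A α x)).re ≤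
      (inner ℂ x ((1 - A 1) x)).re + ∑ α ∈ s, (inner ℂ (y α) ((1 - A 1) (y α))).re := by
  obtain ⟨J⟩ := exists_isometry_of_infinite (n := n) hH
  suffices h : ∀ r ∈ Set.Ico (0 : ℝ) 1,
      ∑ α ∈ s, (inner ℂ (y α) (A α x)).re * r ^ α.totalLength ≤
      (inner ℂ x ((1 - A 1) x)).re + ∑ α ∈ s, (inner ℂ (y α) ((1 - A 1) (y α))).re by
    have h1 : (1 : ℝ) ∈ closure (Set.Ico (0 : ℝ) 1) := by
      rw [closure_Ico (by norm_num)]; simp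
    simpa using closure_minimal (t := {r : ℝ | ∑ α ∈ s, (inner ℂ (y α) (A α x)).re *
      r ^ α.totalLength ≤ (inner ℂ x ((1 - A 1) x)).re +
        ∑ α ∈ s, (inner ℂ (y α) ((1 - A 1) (y α))).re}) h
      (isClosed_le (by fun_prop) continuous_const) h1
  rintro r ⟨hr0, hr1⟩
  set e : PolyWord n → H := fun β => J (PolyFock.basisVec β) with he
  set F := freeEval A (scaledModel J r)
  have hon : Orthonormal ℂ e := PolyFock.orthonormal_basisVec.comp_linearIsometry J
  have hmul : ∀ (z z' : K) β γ, inner ℂ (hilbertTmul z' (e (γ * β))) (F (hilbertTmul z (e β))) =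
      inner ℂ z' (A γ z) * (r : ℂ) ^ γ.totalLength :=
    inner_freeEval_scaledModel_mul hF J hr0 hr1
  have hzero : ∀ (z z' : K) {β ω}, (∀ γ, γ * β ≠ ω) →
      inner ℂ (hilbertTmul z' (e ω)) (F (hilbertTmul z (e β))) = 0 := fun z z' _ _ h =>
    inner_freeEval_scaledModel_eq_zero hF J hr0 hr1 z z' h
  have hlen : (1 : PolyWord n).totalLength = 0 := by simp [PolyWord.totalLength]
  have hone : ∀ (z z' : K) β, inner ℂ (hilbertTmul z' (e β)) (F (hilbertTmul z (e β))) =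
      inner ℂ z' (A 1 z) := fun z z' β => by
    simpa [hlen] using hmul z z' β 1
  set η := ∑ β ∈ s, hilbertTmul (y β) (e β) with hη
  set ξ := hilbertTmul x (e 1) with hξ
  have h11 : inner ℂ ξ (F ξ) = inner ℂ x (A 1 x) := hone x x 1
  have h21 : inner ℂ η (F ξ) =
      ∑ α ∈ s, inner ℂ (y α) (A α x) * (r : ℂ) ^ α.totalLength := by
    rw [hη, sum_inner]
    exact Finset.sum_congr rfl fun α _ => by simpa using hmul x (y α) 1 α
  have h12 : inner ℂ ξ (F η) = 0 := by
    rw [hη, map_sum, inner_sum]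
    refine Finset.sum_eq_zero fun β hβ => hzero _ _ fun γ hγ => hs1 ?_
    have : β = 1 := funext fun i => by
      have := congrArg FreeMonoid.length (congrFun hγ i)
      simp only [Pi.mul_apply, FreeMonoid.length_mul, Pi.one_apply, FreeMonoid.length_one] at this
      exact FreeMonoid.length_eq_zero.1 (by omega)
    exact this ▸ hβ
  have h22 : inner ℂ η (F η) = ∑ α ∈ s, inner ℂ (y α) (A 1 (y α)) := by
    rw [hη, sum_inner]
    refine Finset.sum_congr rfl fun ω hω => ?_
    rw [map_sum, inner_sum, Finset.sum_eq_single ω (fun β hβ hne => ?_) (fun h => absurd hω h)]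
    · exact hone _ _ _
    · exact hzero _ _ fun γ hγ => hne (hs β hβ ω hω fun i => ⟨γ i, (congrFun hγ i).symm⟩)
  have hnorm : ‖ξ + η‖ ^ 2 = (inner ℂ x x).re + ∑ α ∈ s, (inner ℂ (y α) (y α)).re := by
    classical
    have hi : ∀ (z z' : K) β ω, inner ℂ (hilbertTmul z (e β)) (hilbertTmul z' (e ω)) =
        if β = ω then inner ℂ z z' else 0 := fun z z' β ω => by
      rw [inner_hilbertTmul, orthonormal_iff_ite.1 hon]
      split_ifs <;> simp
    have h1 : ∀ β ∈ s, (1 : PolyWord n) ≠ β := fun β hβ h => hs1 (h ▸ hβ)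
    have hξη : inner ℂ ξ η = 0 := by
      rw [hη, inner_sum]
      exact Finset.sum_eq_zero fun β hβ => by rw [hξ, hi, if_neg (h1 β hβ)]
    have hηη : inner ℂ η η = ∑ α ∈ s, inner ℂ (y α) (y α) := by
      rw [hη, sum_inner]
      refine Finset.sum_congr rfl fun ω hω => ?_
      simp only [inner_sum, hi]
      simp [hω]
    rw [← inner_self_eq_norm_sq (𝕜 := ℂ), inner_add_left, inner_add_right, inner_add_right, hξη,
      ← inner_conj_symm η ξ, hξη, hηη, hξ, hi]
    simp
  have key := re_inner_le_of_realPart_le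
    (hRe _ (scaledModel_mem_regularPolyball J hr0 hr1)) (ξ + η)
  change (inner ℂ (ξ + η) (F (ξ + η))).re ≤ _ at key
  rw [map_add, inner_add_left, inner_add_right, inner_add_right, h11, h12, h21, h22, hnorm] at key
  simp only [← Complex.ofReal_pow, Complex.add_re, Complex.re_sum, Complex.re_mul_ofReal,
    Complex.zero_re] at key
  simp only [sub_apply, one_apply_eq_self, inner_sub_right, Complex.sub_re, Finset.sum_sub_distrib]
  linarith

/-- The coefficient estimate `∑_{α ∈ s} A_α^* A_α ≤ 4 ‖I - A_0‖²` over an antichain. -/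
theorem sum_norm_coeff_sq_le (hH : ¬ FiniteDimensional ℂ H) (hF : IsFreeHolomorphic.{u, v} A)
    (hRe : ∀ X ∈ regularPolyball n H,
      (realPart (freeEval A X) : HilbertTensor K H →L[ℂ] HilbertTensor K H) ≤ 1)
    (s : Finset (PolyWord n)) (hs : ∀ ω ∈ s, ∀ γ ∈ s, ω.RightLE γ → ω = γ) (hs1 : 1 ∉ s)
    (x : K) : ∑ α ∈ s, ‖A α x‖ ^ 2 ≤ (2 * ‖1 - A 1‖) ^ 2 * ‖x‖ ^ 2 := by
  set b := ‖1 - A 1‖ with hb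
  set a := ∑ α ∈ s, ‖A α x‖ ^ 2 with ha
  have hQ : ∀ z : K, (inner ℂ z ((1 - A 1) z)).re ≤ b * ‖z‖ ^ 2 := fun z =>
    calc _ ≤ ‖inner ℂ z ((1 - A 1) z)‖ := Complex.re_le_norm _
      _ ≤ ‖z‖ * ‖(1 - A 1) z‖ := norm_inner_le_norm _ _
      _ ≤ ‖z‖ * (b * ‖z‖) := by gcongr; exact le_opNorm _ _
      _ = _ := by ring
  have key : ∀ c : ℝ, c * a ≤ b * ‖x‖ ^ 2 + c ^ 2 * b * a := fun c => by
    have h := re_sum_inner_coeff_le hH hF hRe s hs hs1 x fun α => (c : ℂ) • A α x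
    have h1 : ∀ α, (inner ℂ ((c : ℂ) • A α x) (A α x)).re = c * ‖A α x‖ ^ 2 := fun α => by
      rw [inner_smul_left, Complex.conj_ofReal, Complex.re_ofReal_mul]
      congr 1
      exact inner_self_eq_norm_sq (𝕜 := ℂ) _
    simp only [h1, ← Finset.mul_sum] at h
    refine h.trans (add_le_add (hQ x) ?_)
    rw [ha, Finset.mul_sum]
    refine Finset.sum_le_sum fun α _ => (hQ _).trans (le_of_eq ?_)
    rw [norm_smul, Complex.norm_real, mul_pow, Real.norm_eq_abs, sq_abs]
    ring
  rcases (norm_nonneg (1 - A 1)).eq_or_lt with h | h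
  · rw [← hb] at h
    have := key 1
    rw [← h] at this ⊢
    linarith
  · rw [← hb] at h
    -- The value of `c` that optimizes the constant in `key`.
    have := key (1 / (2 * b))
    have h2 : (1 / (2 * b)) ^ 2 * b * a = a / (4 * b) := by field_simp; ring
    have h3 : 1 / (2 * b) * a = a / (2 * b) := by ring
    rw [h2, h3] at this
    have h4 : a / (2 * b) = 2 * (a / (4 * b)) := by field_simp; ring
    have h5 : a / (4 * b) ≤ b * ‖x‖ ^ 2 := by linarith
    rw [div_le_iff₀ (by positivity)] at h5
    linarith

theorem one_sub_coeff_one_nonneg [CompleteSpace K] (hH : ¬ FiniteDimensional ℂ H) (hF : IsFreeHolomorphic.{u, v} A)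
    (hRe : ∀ X ∈ regularPolyball n H,
      (realPart (freeEval A X) : HilbertTensor K H →L[ℂ] HilbertTensor K H) ≤ 1)
    (hA : 0 ≤ A 1) : 0 ≤ 1 - A 1 := by
  rw [ContinuousLinearMap.nonneg_iff_isPositive, isPositive_def']
  -- `re_sum_inner_coeff_le` over the empty antichain.
  refine ⟨(IsSelfAdjoint.one _).sub (IsSelfAdjoint.of_nonneg hA), fun x => ?_⟩
  have h := re_sum_inner_coeff_le hH hF hRe ∅ (by simp) (by simp) x 0
  simp only [Finset.sum_empty, add_zero] at h
  rw [reApplyInnerSelf_apply, inner_re_symm]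
  exact h

/-- If `B + ε = b²` with `b` self-adjoint and invertible, where `B = I - A_0`, then
`A_α = b Z b` with `‖Z‖ ≤ 2` for every `α ≠ 1`. Here `c` stands for `b⁻¹`, and `Z = c^* A_α c`. -/
theorem norm_conj_inv_coeff_le [CompleteSpace K] (hH : ¬ FiniteDimensional ℂ H) (hF : IsFreeHolomorphic.{u, v} A)
    (hRe : ∀ X ∈ regularPolyball n H,
      (realPart (freeEval A X) : HilbertTensor K H →L[ℂ] HilbertTensor K H) ≤ 1)
    {α : PolyWord n} (hα : α ≠ 1) {ε : ℝ} (hε : 0 ≤ ε) {b c : K →L[ℂ] K}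
    (hb : IsSelfAdjoint b) (hbb : b * b = 1 - A 1 + (ε : ℂ) • 1) (hbc : b * c = 1) :
    ‖adjoint c * A α * c‖ ≤ 2 := by
  -- The form of `B` at `c x` is at most that of `B + ε = b²`, which is `‖b c x‖² = ‖x‖²`.
  have hQ : ∀ x, (inner ℂ (c x) ((1 - A 1) (c x))).re ≤ ‖x‖ ^ 2 := fun x => by
    have h1 : b (c x) = x := DFunLike.congr_fun hbc x
    have h2 : (inner ℂ (c x) ((b * b) (c x))).re = ‖x‖ ^ 2 := by
      rw [mul_apply_eq_comp, h1, ← adjoint_inner_left, ← star_eq_adjoint, hb.star_eq, h1]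
      exact inner_self_eq_norm_sq (𝕜 := ℂ) x
    rw [hbb, add_apply, inner_add_right, smul_apply, inner_smul_right, Complex.add_re,
      Complex.re_ofReal_mul, one_apply_eq_self] at h2
    have h3 : 0 ≤ (inner ℂ (c x) (c x)).re := inner_self_nonneg (𝕜 := ℂ)
    nlinarith
  refine opNorm_le_bound _ zero_le_two fun x => ?_
  set y := (adjoint c * A α * c) x with hy
  have key : ∀ t : ℝ, t * ‖y‖ ^ 2 ≤ ‖x‖ ^ 2 + t ^ 2 * ‖y‖ ^ 2 := fun t => by
    have h := re_sum_inner_coeff_le hH hF hRe {α} (by simp) (by simpa using hα.symm) (c x)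
      fun _ => c ((t : ℂ) • y)
    simp only [Finset.sum_singleton] at h
    have h1 : (inner ℂ (c ((t : ℂ) • y)) (A α (c x))).re = t * ‖y‖ ^ 2 := by
      rw [← adjoint_inner_right, inner_smul_left, Complex.conj_ofReal, Complex.re_ofReal_mul]
      congr 1
      exact inner_self_eq_norm_sq (𝕜 := ℂ) y
    rw [h1] at h
    refine h.trans (add_le_add (hQ x) ((hQ _).trans (le_of_eq ?_)))
    rw [norm_smul, Complex.norm_real, mul_pow, Real.norm_eq_abs, sq_abs]
  refine le_of_sq_le_sq ?_ (by positivity)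
  have := key (1 / 2)
  rw [mul_pow]
  linarith

end Coefficients

/-! ### Convergence of the weighted sums -/

section Bohr

variable {k : ℕ} {n : Fin k → ℕ}
  {E : Type*} [NormedAddCommGroup E] [InnerProductSpace ℂ E]
  {K : Type*} [NormedAddCommGroup K] [InnerProductSpace ℂ K]
  {G : Type*} [NormedAddCommGroup G] [InnerProductSpace ℂ G]

theorem opTensor_opTensor_eq_mul (C : E →L[ℂ] E) (A : K →L[ℂ] K) (X : G →L[ℂ] G) :
    opTensor C (opTensor A X) =
      opTensor 1 (opTensor 1 X) * (opTensor C 1 * opTensor 1 (opTensor A 1)) := by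
  simp only [← opTensor_mul, one_mul, mul_one]

variable [CompleteSpace E] [CompleteSpace K] [CompleteSpace G]

/-- The ampliation `A ↦ I ⊗ A ⊗ I`. -/
noncomputable def ampMid : (K →L[ℂ] K) →⋆ₐ[ℂ]
    (HilbertTensor E (HilbertTensor K G) →L[ℂ] HilbertTensor E (HilbertTensor K G)) :=
  ampRight.comp ampLeft

theorem ampMid_apply (A : K →L[ℂ] K) : (ampMid A : HilbertTensor E (HilbertTensor K G) →L[ℂ]
    HilbertTensor E (HilbertTensor K G)) = opTensor 1 (opTensor A 1) := rfl

theorem norm_ampMid_le (A : K →L[ℂ] K) :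
    ‖(ampMid A : HilbertTensor E (HilbertTensor K G) →L[ℂ] _)‖ ≤ ‖A‖ :=
  NonUnitalStarAlgHom.norm_apply_le (ampMid : (K →L[ℂ] K) →⋆ₐ[ℂ] _) A

theorem HasStrongSum.unique {ι V : Type*} [NormedAddCommGroup V] [InnerProductSpace ℂ V]
    {T : ι → V →L[ℂ] V} {S S' : V →L[ℂ] V} (h : HasStrongSum T S) (h' : HasStrongSum T S') :
    S = S' :=
  ContinuousLinearMap.ext fun v => (h v).unique (h' v)

theorem hasStrongSum_singleton {ι V : Type*} [NormedAddCommGroup V] [InnerProductSpace ℂ V]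
    (T : ι → V →L[ℂ] V) {Λ : Set ι} {i : ι} (hΛ : Λ = {i}) :
    HasStrongSum (fun j : Λ => T j) (T i) := by
  subst hΛ
  exact fun v => hasSum_unique fun j : ({i} : Set ι) => T j v

/-- The row `[I ⊗ I ⊗ X_α : α ∈ Λ]` is a contraction. -/
theorem sum_norm_adjoint_amp_word_sq_le {X : OpTuple n G} (hX : X ∈ closure (regularPolyball n G))
    {Λ : Set (PolyWord n)} (hΛ : IsOrthogonalSet Λ) (s : Finset Λ)
    (h : HilbertTensor E (HilbertTensor K G)) :
    ∑ α ∈ s, ‖adjoint (opTensor (1 : E →L[ℂ] E) (opTensor (1 : K →L[ℂ] K) (X.word α))) h‖ ^ 2 ≤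
      ‖h‖ ^ 2 := by
  have h1 := StarAlgHom.sum_norm_sq_le
    ((ampRight.comp ampRight : (G →L[ℂ] G) →⋆ₐ[ℂ]
      (HilbertTensor E (HilbertTensor K G) →L[ℂ] HilbertTensor E (HilbertTensor K G)))) s
    (fun α => adjoint (X.word α)) zero_le_one
    (by simpa using sum_norm_adjoint_word_sq_le_of_mem_closure hX hΛ s) h
  rw [one_mul] at h1
  refine (Finset.sum_congr rfl fun α _ => ?_).trans_le h1
  have h2 : adjoint (opTensor (1 : E →L[ℂ] E) (opTensor (1 : K →L[ℂ] K) (X.word α))) =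
      (ampRight.comp ampRight : (G →L[ℂ] G) →⋆ₐ[ℂ] _) (adjoint (X.word α)) :=
    (map_star (ampRight.comp ampRight : (G →L[ℂ] G) →⋆ₐ[ℂ] _) (X.word α)).symm
  rw [h2]

/-- Convergence when the column `(A_α)` is bounded and the `C_α` are uniformly bounded. -/
theorem exists_hasStrongSum_of_norm_le {X : OpTuple n G} (hX : X ∈ closure (regularPolyball n G))
    {Λ : Set (PolyWord n)} (hΛ : IsOrthogonalSet Λ) {C : PolyWord n → E →L[ℂ] E}
    {A : PolyWord n → K →L[ℂ] K} {c a : ℝ} (hc : 0 ≤ c) (ha : 0 ≤ a) (hC : ∀ α ∈ Λ, ‖C α‖ ≤ c)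
    (hA : ∀ s : Finset Λ, ∀ x, ∑ α ∈ s, ‖A α x‖ ^ 2 ≤ a ^ 2 * ‖x‖ ^ 2) :
    ∃ T, HasStrongSum (fun α : Λ => opTensor (C α) (opTensor (A α) (X.word α))) T ∧
      ‖T‖ ≤ c * a := by
  have hT : (fun α : Λ => opTensor (C α) (opTensor (A α) (X.word α))) = fun α : Λ =>
      opTensor 1 (opTensor 1 (X.word α)) * (opTensor (C α) 1 * opTensor 1 (opTensor (A α) 1)) :=
    funext fun α => opTensor_opTensor_eq_mul _ _ _
  rw [hT]
  refine exists_hasStrongSum_row_mul_column _ _ (by positivity)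
    (sum_norm_adjoint_amp_word_sq_le hX hΛ) fun s v => ?_
  calc ∑ α ∈ s, ‖(opTensor (C α) 1 * opTensor 1 (opTensor (A α) 1) :
        HilbertTensor E (HilbertTensor K G) →L[ℂ] _) v‖ ^ 2
      ≤ ∑ α ∈ s, c ^ 2 * ‖(ampMid (A α) : HilbertTensor E (HilbertTensor K G) →L[ℂ] _) v‖ ^ 2 := by
        refine Finset.sum_le_sum fun α _ => ?_
        rw [← mul_pow, mul_apply_eq_comp, ampMid_apply]
        gcongr
        refine (le_opNorm _ _).trans ?_
        gcongr
        rw [← ampLeft_apply]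
        exact (norm_ampLeft_le _).trans (hC α α.2)
    _ ≤ c ^ 2 * (a ^ 2 * ‖v‖ ^ 2) := by
        rw [← Finset.mul_sum]
        gcongr
        exact StarAlgHom.sum_norm_sq_le ampMid s (fun α : Λ => A α) (by positivity) (hA s) v
    _ = _ := by ring

theorem HasStrongSum.sum_norm_sq_le {ι : Type*} {C : ι → E →L[ℂ] E} {D : E →L[ℂ] E}
    (hD : HasStrongSum (fun i => adjoint (C i) * C i) D) (s : Finset ι) (x : E) :
    ∑ i ∈ s, ‖C i x‖ ^ 2 ≤ ‖D‖ * ‖x‖ ^ 2 := by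
  have h1 : HasSum (fun i => ‖C i x‖ ^ 2) (inner ℂ x (D x)).re := by
    have h := Complex.reCLM.hasSum ((innerSL ℂ x).hasSum (hD x))
    simp only [innerSL_apply_apply, Complex.reCLM_apply] at h
    have h2 : ∀ i, (inner ℂ x ((adjoint (C i) * C i) x)).re = ‖C i x‖ ^ 2 := fun i => by
      rw [mul_apply_eq_comp, adjoint_inner_right]
      exact inner_self_eq_norm_sq (𝕜 := ℂ) _
    simpa only [h2] using h
  calc _ ≤ (inner ℂ x (D x)).re := sum_le_hasSum s (fun i _ => by positivity) h1
    _ ≤ ‖inner ℂ x (D x)‖ := Complex.re_le_norm _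
    _ ≤ ‖x‖ * ‖D x‖ := norm_inner_le_norm _ _
    _ ≤ ‖x‖ * (‖D‖ * ‖x‖) := by gcongr; exact le_opNorm _ _
    _ = _ := by ring

/-- Convergence when the column `(C_α)` is bounded and the `A_α` are uniformly bounded. -/
theorem exists_hasStrongSum_of_column {X : OpTuple n G} (hX : X ∈ closure (regularPolyball n G))
    {Λ : Set (PolyWord n)} (hΛ : IsOrthogonalSet Λ) {C : PolyWord n → E →L[ℂ] E}
    {A : PolyWord n → K →L[ℂ] K} {D : E →L[ℂ] E} {a : ℝ} (ha : 0 ≤ a)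
    (hD : HasStrongSum (fun α : Λ => adjoint (C α) * C α) D) (hA : ∀ α ∈ Λ, ‖A α‖ ≤ a) :
    ∃ T, HasStrongSum (fun α : Λ => opTensor (C α) (opTensor (A α) (X.word α))) T ∧
      ‖T‖ ≤ a * ‖D‖ ^ (1 / 2 : ℝ) := by
  have hT : (fun α : Λ => opTensor (C α) (opTensor (A α) (X.word α))) = fun α : Λ =>
      opTensor 1 (opTensor 1 (X.word α)) * (opTensor (C α) 1 * opTensor 1 (opTensor (A α) 1)) :=
    funext fun α => opTensor_opTensor_eq_mul _ _ _
  rw [hT]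
  refine exists_hasStrongSum_row_mul_column _ _ (by positivity)
    (sum_norm_adjoint_amp_word_sq_le hX hΛ) fun s v => ?_
  calc ∑ α ∈ s, ‖(opTensor (C α) 1 * opTensor 1 (opTensor (A α) 1) :
        HilbertTensor E (HilbertTensor K G) →L[ℂ] _) v‖ ^ 2
      ≤ ∑ α ∈ s, a ^ 2 * ‖(ampLeft (C α) : HilbertTensor E (HilbertTensor K G) →L[ℂ] _) v‖ ^ 2 := by
        refine Finset.sum_le_sum fun α _ => ?_
        have : (opTensor (C α) 1 * opTensor 1 (opTensor (A α) 1) :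
            HilbertTensor E (HilbertTensor K G) →L[ℂ] _) =
            opTensor 1 (opTensor (A α) 1) * opTensor (C α) 1 := by
          rw [← opTensor_mul, ← opTensor_mul, one_mul, one_mul, mul_one, mul_one]
        rw [← mul_pow, this, mul_apply_eq_comp, ampLeft_apply]
        gcongr
        refine (le_opNorm _ _).trans ?_
        gcongr
        rw [← ampMid_apply]
        exact (norm_ampMid_le _).trans (hA α α.2)
    _ ≤ a ^ 2 * (‖D‖ * ‖v‖ ^ 2) := by
        rw [← Finset.mul_sum]
        gcongr
        exact StarAlgHom.sum_norm_sq_le ampLeft s (fun α : Λ => C α) (norm_nonneg _)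
          (hD.sum_norm_sq_le s) v
    _ = _ := by
        rw [mul_pow, ← Real.sqrt_eq_rpow, Real.sq_sqrt (norm_nonneg _)]
        ring

/-- If `‖a v‖² + ‖b v‖² ≤ c ‖v‖²`, the operator `a M a + b N b` is bounded by `c` for contractions
`M` and `N`. -/
theorem norm_conj_add_conj_le {V : Type*} [NormedAddCommGroup V] [InnerProductSpace ℂ V]
    [CompleteSpace V] {a b M N : V →L[ℂ] V} {c : ℝ} (hc : 0 ≤ c) (ha : IsSelfAdjoint a)
    (hb : IsSelfAdjoint b) (hM : ‖M‖ ≤ 1) (hN : ‖N‖ ≤ 1)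
    (hab : ∀ v, ‖a v‖ ^ 2 + ‖b v‖ ^ 2 ≤ c * ‖v‖ ^ 2) : ‖a * M * a + b * N * b‖ ≤ c := by
  refine opNorm_le_bound _ hc fun v => le_of_sq_le_sq ?_ (by positivity)
  have h1 := norm_sum_apply_sq_le Finset.univ (fun i : Bool => cond i a b)
    (fun i => cond i (M (a v)) (N (b v))) hc fun h => by
      simpa [← star_eq_adjoint, ha.star_eq, hb.star_eq] using hab h
  simp only [Fintype.sum_bool, cond_true, cond_false] at h1
  have hM' : ‖M (a v)‖ ≤ ‖a v‖ := by
    simpa using (le_opNorm M (a v)).trans (mul_le_mul_of_nonneg_right hM (norm_nonneg _))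
  have hN' : ‖N (b v)‖ ≤ ‖b v‖ := by
    simpa using (le_opNorm N (b v)).trans (mul_le_mul_of_nonneg_right hN (norm_nonneg _))
  calc ‖(a * M * a + b * N * b) v‖ ^ 2 ≤ c * (‖M (a v)‖ ^ 2 + ‖N (b v)‖ ^ 2) := h1
    _ ≤ c * (‖a v‖ ^ 2 + ‖b v‖ ^ 2) := by gcongr
    _ ≤ c * (c * ‖v‖ ^ 2) := mul_le_mul_of_nonneg_left (hab v) hc
    _ = _ := by ring

/-- The quadratic form of `a² + b² = c`. -/
theorem norm_sq_add_norm_sq_of_mul_self {a b : K →L[ℂ] K} {c : ℝ} (ha : IsSelfAdjoint a)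
    (hb : IsSelfAdjoint b) (hab : a * a + b * b = (c : ℂ) • 1) (x : K) :
    ‖a x‖ ^ 2 + ‖b x‖ ^ 2 = c * ‖x‖ ^ 2 := by
  have h1 := re_inner_sum_adjoint_mul Finset.univ (fun i : Bool => cond i a b) x
  simp only [Fintype.sum_bool, cond_true, cond_false, ← star_eq_adjoint, ha.star_eq,
    hb.star_eq, hab] at h1
  rw [← h1, smul_apply, one_apply_eq_self, inner_smul_left, Complex.conj_ofReal,
    Complex.re_ofReal_mul]
  congr 1
  exact inner_self_eq_norm_sq (𝕜 := ℂ) x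

/-- A self-adjoint square root `b` of `B + ε`, with its inverse `c`. -/
theorem exists_invertible_sqrt {B : K →L[ℂ] K} (hB : 0 ≤ B) {ε : ℝ} (hε : 0 < ε) :
    ∃ b c : K →L[ℂ] K, IsSelfAdjoint b ∧ b * b = B + (ε : ℂ) • 1 ∧ b * c = 1 ∧ c * b = 1 := by
  have h1 : (0 : K →L[ℂ] K) ≤ (ε : ℂ) • 1 := by
    rw [Complex.coe_smul]
    exact smul_nonneg hε.le zero_le_one
  have h2 : IsStrictlyPositive ((ε : ℂ) • (1 : K →L[ℂ] K)) :=
    IsStrictlyPositive.iff_of_unital.2 ⟨h1, (isUnit_one).smul (Units.mk0 (ε : ℂ) (by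
      exact_mod_cast hε.ne'))⟩
  have h3 : IsUnit (B + (ε : ℂ) • 1) := CStarAlgebra.isUnit_of_le _ (le_add_of_nonneg_left hB) h2
  have h4 : 0 ≤ B + (ε : ℂ) • 1 := add_nonneg hB h1
  obtain ⟨d, hd⟩ := (CFC.isUnit_sqrt_iff _ h4).2 h3
  refine ⟨CFC.sqrt (B + (ε : ℂ) • 1), ↑d⁻¹, IsSelfAdjoint.of_nonneg (CFC.sqrt_nonneg _),
    CFC.sqrt_mul_sqrt_self _ h4, ?_, ?_⟩
  · rw [← hd]; simp
  · rw [← hd]; simp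

theorem isSelfAdjoint_ampMid {a : K →L[ℂ] K} (ha : IsSelfAdjoint a) :
    IsSelfAdjoint (ampMid a : HilbertTensor E (HilbertTensor K G) →L[ℂ]
      HilbertTensor E (HilbertTensor K G)) := ha.map ampMid

end Bohr

/-! ### The Bohr inequalities -/

section Main

variable {k : ℕ} {n : Fin k → ℕ} {Sig : ℕ → Set (PolyWord n)}

theorem IsMinimalOrthogonalExhaustion.one_notMem (hSig : IsMinimalOrthogonalExhaustion Sig)
    (m : ℕ) : 1 ∉ Sig (m + 1) := fun h =>
  Set.disjoint_left.1 (hSig.disjoint 0 (m + 1) (by omega)) (hSig.zero ▸ Set.mem_singleton _) h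

variable {K : Type v} [NormedAddCommGroup K] [InnerProductSpace ℂ K]
  {H : Type u} [NormedAddCommGroup H] [InnerProductSpace ℂ H] [CompleteSpace H]
  {A : PolyWord n → K →L[ℂ] K}
  {E : Type w} [NormedAddCommGroup E] [InnerProductSpace ℂ E] [CompleteSpace E]
  {C : PolyWord n → E →L[ℂ] E}

theorem sum_norm_coeff_sq_le_of_exhaustion (hH : ¬ FiniteDimensional ℂ H)
    (hF : IsFreeHolomorphic.{u, v} A)
    (hRe : ∀ X ∈ regularPolyball n H,
      (realPart (freeEval A X) : HilbertTensor K H →L[ℂ] HilbertTensor K H) ≤ 1)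
    (hSig : IsMinimalOrthogonalExhaustion Sig) (m : ℕ) (s : Finset (Sig (m + 1))) (x : K) :
    ∑ α ∈ s, ‖A α x‖ ^ 2 ≤ (2 * ‖1 - A 1‖) ^ 2 * ‖x‖ ^ 2 := by
  have h := sum_norm_coeff_sq_le hH hF hRe (s.map (Function.Embedding.subtype _))
    (fun ω hω γ hγ => ?_) (fun h1 => ?_) x
  · simpa using h
  · simp only [Finset.mem_map, Function.Embedding.subtype_apply] at hω hγ
    obtain ⟨ω, -, rfl⟩ := hω
    obtain ⟨γ, -, rfl⟩ := hγ
    exact (hSig.minimal (m + 1)).1 ω ω.2 γ γ.2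
  · simp only [Finset.mem_map, Function.Embedding.subtype_apply] at h1
    obtain ⟨ω, -, hω⟩ := h1
    exact hSig.one_notMem m (hω ▸ ω.2)

variable [CompleteSpace K]

/-- The Bohr inequality for uniformly bounded coefficients `C_α`. -/
theorem exists_sums_of_tsum_iSup_norm_le (hH : ¬ FiniteDimensional ℂ H)
    (hF : IsFreeHolomorphic.{u, v} A)
    (hRe : ∀ X ∈ regularPolyball n H,
      (realPart (freeEval A X) : HilbertTensor K H →L[ℂ] HilbertTensor K H) ≤ 1)
    (hSig : IsMinimalOrthogonalExhaustion Sig) (hC0 : ‖C 1‖ ≤ 1)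
    (hC : (∑' m : ℕ, ⨆ α ∈ Sig (m + 1), ‖C α‖ₑ) ≤ 1 / 2)
    (G : Type x) [NormedAddCommGroup G] [InnerProductSpace ℂ G] [CompleteSpace G] :
    ∃ T : ℕ → OpTuple n G →
        (HilbertTensor E (HilbertTensor K G) →L[ℂ] HilbertTensor E (HilbertTensor K G)),
      (∀ m, ∀ X ∈ closure (regularPolyball n G),
        HasStrongSum (fun α : Sig m => opTensor (C α) (opTensor (A α) (X.word α))) (T m X)) ∧
      (∑' m : ℕ, ⨆ X ∈ closure (regularPolyball n G), ‖T m X‖ₑ) ≤ ‖A 1‖ₑ + ‖1 - A 1‖ₑ := by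
  set c : ℕ → ℝ≥0∞ := fun m => ⨆ α ∈ Sig (m + 1), ‖C α‖ₑ with hc
  have hctop : ∀ m, c m ≠ ∞ := fun m =>
    ne_top_of_le_ne_top (by norm_num) ((ENNReal.le_tsum m).trans hC)
  have h0 : ∀ X : OpTuple n G, ∃ T : HilbertTensor E (HilbertTensor K G) →L[ℂ]
      HilbertTensor E (HilbertTensor K G), (X ∈ closure (regularPolyball n G) →
        HasStrongSum (fun α : Sig 0 => opTensor (C α) (opTensor (A α) (X.word α))) T) ∧
      ‖T‖ₑ ≤ ‖A 1‖ₑ := fun X => by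
    refine ⟨_, fun _ => hasStrongSum_singleton
      (fun α => opTensor (C α) (opTensor (A α) (X.word α))) hSig.zero, ?_⟩
    rw [← ofReal_norm, ← ofReal_norm, OpTuple.word_one]
    refine ENNReal.ofReal_le_ofReal ?_
    refine (norm_opTensor_le _ _).trans ?_
    calc ‖C 1‖ * ‖opTensor (A 1) (1 : G →L[ℂ] G)‖ ≤ 1 * ‖A 1‖ := by
          gcongr
          exact norm_ampLeft_le (A 1)
      _ = _ := one_mul _
  have h1 : ∀ m, ∀ X : OpTuple n G, ∃ T : HilbertTensor E (HilbertTensor K G) →L[ℂ]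
      HilbertTensor E (HilbertTensor K G), (X ∈ closure (regularPolyball n G) →
        HasStrongSum (fun α : Sig (m + 1) => opTensor (C α) (opTensor (A α) (X.word α))) T) ∧
      ‖T‖ₑ ≤ c m * (2 * ‖1 - A 1‖ₑ) := fun m X => by
    by_cases hX : X ∈ closure (regularPolyball n G)
    · obtain ⟨T, hT, hTn⟩ := exists_hasStrongSum_of_norm_le (E := E) (K := K) hX
        (hSig.orthogonal (m + 1)) (C := C) (A := A) (c := (c m).toReal) (a := 2 * ‖1 - A 1‖)
        ENNReal.toReal_nonneg (by positivity) (fun α hα => by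
          rw [← toReal_enorm]
          exact ENNReal.toReal_mono (hctop m) (le_iSup₂ (f := fun α _ => ‖C α‖ₑ) α hα))
        (sum_norm_coeff_sq_le_of_exhaustion hH hF hRe hSig m)
      refine ⟨T, fun _ => hT, ?_⟩
      rw [← ofReal_norm]
      refine (ENNReal.ofReal_le_ofReal hTn).trans (le_of_eq ?_)
      rw [ENNReal.ofReal_mul ENNReal.toReal_nonneg, ENNReal.ofReal_toReal (hctop m),
        ENNReal.ofReal_mul zero_le_two, ofReal_norm]
      simp
    -- Outside the closed polyball the value of `T` is irrelevant.
    · exact ⟨0, fun h => absurd h hX, by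
        rw [← ofReal_norm, opNorm_zero, ENNReal.ofReal_zero]
        exact zero_le⟩
  choose T₀ hT₀ hT₀n using h0
  choose T₁ hT₁ hT₁n using h1
  refine ⟨fun m => Nat.casesOn m T₀ T₁, fun m => ?_, ?_⟩
  · cases m with
    | zero => exact hT₀
    | succ m => exact hT₁ m
  · rw [tsum_eq_zero_add' ENNReal.summable]
    refine add_le_add (iSup₂_le fun X _ => hT₀n X) ?_
    calc (∑' m : ℕ, ⨆ X ∈ closure (regularPolyball n G), ‖T₁ m X‖ₑ)
        ≤ ∑' m, c m * (2 * ‖1 - A 1‖ₑ) := ENNReal.tsum_le_tsum fun m => iSup₂_le fun X _ => hT₁n m X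
      _ = (∑' m, c m) * (2 * ‖1 - A 1‖ₑ) := ENNReal.tsum_mul_right
      _ ≤ 1 / 2 * (2 * ‖1 - A 1‖ₑ) := by gcongr
      _ = ‖1 - A 1‖ₑ := by
          rw [← mul_assoc, one_div, ENNReal.inv_mul_cancel two_ne_zero ENNReal.ofNat_ne_top, one_mul]

/-- Converts a bound on an extended sum of roots of norms into summability and a real bound. -/
theorem summable_and_tsum_le_of_tsum_enorm_rpow_le {V : Type*} [NormedAddCommGroup V]
    {D : ℕ → V} (hD : (∑' m : ℕ, ‖D m‖ₑ ^ (1 / 2 : ℝ)) ≤ 1 / 2) :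
    Summable (fun m => ‖D m‖ ^ (1 / 2 : ℝ)) ∧ ∑' m, ‖D m‖ ^ (1 / 2 : ℝ) ≤ 1 / 2 := by
  have h1 : ∀ m, (‖D m‖ₑ ^ (1 / 2 : ℝ)).toReal = ‖D m‖ ^ (1 / 2 : ℝ) := fun m => by
    rw [← ENNReal.toReal_rpow, toReal_enorm]
  have htop : (∑' m : ℕ, ‖D m‖ₑ ^ (1 / 2 : ℝ)) ≠ ∞ := ne_top_of_le_ne_top (by norm_num) hD
  refine ⟨by simpa only [h1] using ENNReal.summable_toReal htop, ?_⟩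
  simp_rw [← h1]
  rw [← ENNReal.tsum_toReal_eq (ENNReal.ne_top_of_tsum_ne_top htop)]
  simpa using ENNReal.toReal_mono (by norm_num) hD

set_option maxHeartbeats 1000000 in
/-- The factorization `A_α = b Z_α b` with `b² = I - A_0 + ε` turns the sum of all `T_m` into
`a C_0 a + b M b` with contractions `C_0`, `M` and `a² + b² = 1 + ε`. -/
theorem norm_add_tsum_le (hH : ¬ FiniteDimensional ℂ H)
    (hF : IsFreeHolomorphic.{u, v} A)
    (hRe : ∀ X ∈ regularPolyball n H,
      (realPart (freeEval A X) : HilbertTensor K H →L[ℂ] HilbertTensor K H) ≤ 1)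
    (hA : 0 ≤ A 1) (hSig : IsMinimalOrthogonalExhaustion Sig) (hC0 : ‖C 1‖ ≤ 1)
    {D : ℕ → E →L[ℂ] E}
    (hD : ∀ m, HasStrongSum (fun α : Sig (m + 1) => adjoint (C α) * C α) (D m))
    (hDs : Summable fun m => ‖D m‖ ^ (1 / 2 : ℝ)) (hDle : ∑' m, ‖D m‖ ^ (1 / 2 : ℝ) ≤ 1 / 2)
    {T : ℕ → (HilbertTensor E (HilbertTensor K (PolyFock n)) →L[ℂ]
        HilbertTensor E (HilbertTensor K (PolyFock n)))}
    (hT : ∀ m, HasStrongSum (fun α : Sig (m + 1) =>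
      opTensor (C α) (opTensor (A α) ((universalModel n).word α))) (T m)) {ε : ℝ} (hε : 0 < ε) :
    ‖opTensor (C 1) (opTensor (A 1) (1 : PolyFock n →L[ℂ] PolyFock n)) + ∑' m, T m‖ ≤ 1 + ε := by
  obtain ⟨b, c, hb, hbb, hbc, hcb⟩ :=
    exists_invertible_sqrt (one_sub_coeff_one_nonneg hH hF hRe hA) hε
  obtain ⟨a, hasa, haa⟩ : ∃ a : K →L[ℂ] K, IsSelfAdjoint a ∧ a * a = A 1 :=
    ⟨_, IsSelfAdjoint.of_nonneg (CFC.sqrt_nonneg _), CFC.sqrt_mul_sqrt_self _ hA⟩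
  have hZ : ∀ m, ∀ α ∈ Sig (m + 1), ‖adjoint c * A α * c‖ ≤ 2 := fun m α hα =>
    norm_conj_inv_coeff_le hH hF hRe (fun h => hSig.one_notMem m (h ▸ hα)) hε.le hb hbb hbc
  have hAZ : ∀ α, A α = b * (adjoint c * A α * c) * b := fun α => by
    have h1 : b * adjoint c = 1 := by
      have := congrArg star hcb
      rwa [star_mul, hb.star_eq, star_one, star_eq_adjoint] at this
    calc A α = b * adjoint c * A α * (c * b) := by rw [h1, hcb, one_mul, mul_one]
      _ = _ := by simp only [mul_assoc]
  choose M hM hMn using fun m => exists_hasStrongSum_of_column (E := E) (K := K)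
    universalModel_mem_closure (hSig.orthogonal (m + 1)) zero_le_two (hD m) (hZ m)
  have hTM : ∀ m, T m = ampMid b * M m * ampMid b := fun m => by
    refine (hT m).unique fun v => ?_
    have h1 := (ampMid b : HilbertTensor E (HilbertTensor K (PolyFock n)) →L[ℂ] _).hasSum
      (hM m (ampMid b v))
    have h2 : ∀ α : Sig (m + 1),
        (opTensor (C α) (opTensor (A α) ((universalModel n).word α)) :
          HilbertTensor E (HilbertTensor K (PolyFock n)) →L[ℂ] _) =
        ampMid b * opTensor (C α) (opTensor (adjoint c * A α * c) ((universalModel n).word α)) *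
          ampMid b := fun α => by
      rw [ampMid_apply, ← opTensor_mul, ← opTensor_mul, ← opTensor_mul, ← opTensor_mul, one_mul,
        one_mul, mul_one, mul_one, ← hAZ]
    simp only [h2]
    exact h1
  have hMs : Summable fun m => ‖M m‖ :=
    Summable.of_nonneg_of_le (fun _ => norm_nonneg _) hMn (hDs.mul_left _)
  have hMle : ‖∑' m, M m‖ ≤ 1 := by
    refine (norm_tsum_le_tsum_norm hMs).trans ((hMs.tsum_le_tsum hMn (hDs.mul_left _)).trans ?_)
    rw [tsum_mul_left]
    linarith
  have hTsum : ∑' m, T m = ampMid b * (∑' m, M m) * ampMid b := by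
    rw [tsum_congr hTM]
    exact ((hMs.of_norm.hasSum.mul_left _).mul_right _).tsum_eq
  have hT₀ : opTensor (C 1) (opTensor (A 1) (1 : PolyFock n →L[ℂ] PolyFock n)) =
      ampMid a * opTensor (C 1) 1 * ampMid a := by
    rw [ampMid_apply, ← opTensor_mul, ← opTensor_mul, one_mul, mul_one, mul_one,
      ← opTensor_mul, haa, one_mul]
  have hab : a * a + b * b = ((1 + ε : ℝ) : ℂ) • 1 := by
    rw [haa, hbb, Complex.ofReal_add, add_smul, Complex.ofReal_one, one_smul, ← add_assoc,
      add_sub_cancel]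
  rw [hTsum, hT₀]
  refine norm_conj_add_conj_le (by positivity) (isSelfAdjoint_ampMid hasa) (isSelfAdjoint_ampMid hb)
    ((norm_ampLeft_le (C 1)).trans hC0) hMle fun v => ?_
  have h1 := StarAlgHom.sum_norm_sq_le
    (ampMid : (K →L[ℂ] K) →⋆ₐ[ℂ] (HilbertTensor E (HilbertTensor K (PolyFock n)) →L[ℂ]
      HilbertTensor E (HilbertTensor K (PolyFock n)))) Finset.univ (fun i : Bool => cond i a b)
    (c := 1 + ε) (by positivity)
    (fun x => by simpa using (norm_sq_add_norm_sq_of_mul_self hasa hb hab x).le) v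
  simpa only [Fintype.sum_bool, cond_true, cond_false] using h1

theorem exists_seq_of_zero_of_succ {V : Type*} [NormedAddCommGroup V] [CompleteSpace V]
    {P : ℕ → V → Prop} {T₀ : V} {T₁ : ℕ → V} (h0 : P 0 T₀) (h1 : ∀ m, P (m + 1) (T₁ m))
    (hs : Summable fun m => ‖T₁ m‖) :
    ∃ T : ℕ → V, (∀ m, P m (T m)) ∧ (Summable fun m => ‖T m‖) ∧ ∑' m, T m = T₀ + ∑' m, T₁ m := by
  let T : ℕ → V := fun m => Nat.casesOn m T₀ T₁
  refine ⟨T, fun m => ?_, (summable_nat_add_iff (f := fun m => ‖T m‖) 1).1 hs,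
    tsum_eq_zero_add' (f := T) hs.of_norm⟩
  cases m with
  | zero => exact h0
  | succ m => exact h1 m

/-- The Bohr inequality for coefficients `C_α` with bounded columns. -/
theorem exists_sums_of_tsum_norm_rpow_le (hH : ¬ FiniteDimensional ℂ H)
    (hF : IsFreeHolomorphic.{u, v} A) (hF0 : 0 ≤ freeEval A (0 : OpTuple n H))
    (hRe : ∀ X ∈ regularPolyball n H,
      (realPart (freeEval A X) : HilbertTensor K H →L[ℂ] HilbertTensor K H) ≤ 1)
    (hSig : IsMinimalOrthogonalExhaustion Sig) (hC0 : ‖C 1‖ ≤ 1) (D : ℕ → E →L[ℂ] E)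
    (hD : ∀ m, HasStrongSum (fun α : Sig (m + 1) => adjoint (C α) * C α) (D m))
    (hD2 : (∑' m : ℕ, ‖D m‖ₑ ^ (1 / 2 : ℝ)) ≤ 1 / 2) :
    ∃ T : ℕ → (HilbertTensor E (HilbertTensor K (PolyFock n)) →L[ℂ]
        HilbertTensor E (HilbertTensor K (PolyFock n))),
      (∀ m, HasStrongSum
        (fun α : Sig m => opTensor (C α) (opTensor (A α) ((universalModel n).word α))) (T m)) ∧
      Summable (fun m => ‖T m‖) ∧ ‖∑' m, T m‖ ≤ 1 := by
  obtain ⟨hDs, hDle⟩ := summable_and_tsum_le_of_tsum_enorm_rpow_le hD2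
  have hA1 : ∀ m, ∀ α ∈ Sig (m + 1), ‖A α‖ ≤ 2 * ‖1 - A 1‖ := fun m α hα => by
    refine opNorm_le_bound _ (by positivity) fun x => le_of_sq_le_sq ?_ (by positivity)
    rw [mul_pow]
    simpa using sum_norm_coeff_sq_le_of_exhaustion hH hF hRe hSig m {⟨α, hα⟩} x
  -- This bound only serves to obtain the sums `T_m` and their summability.
  choose T₁ hT₁ hT₁n using fun m => exists_hasStrongSum_of_column (E := E) (K := K)
    universalModel_mem_closure (hSig.orthogonal (m + 1)) (by positivity) (hD m) (hA1 m)
  have hT₀ := hasStrongSum_singleton (fun α => (opTensor (C α) (opTensor (A α)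
    ((universalModel n).word α)) : HilbertTensor E (HilbertTensor K (PolyFock n)) →L[ℂ] _))
    hSig.zero
  rw [OpTuple.word_one] at hT₀
  have hsum₁ : Summable fun m => ‖T₁ m‖ :=
    Summable.of_nonneg_of_le (fun _ => norm_nonneg _) hT₁n (hDs.mul_left _)
  have : Nontrivial H := by
    by_contra h
    rw [not_nontrivial_iff_subsingleton] at h
    exact hH inferInstance
  obtain ⟨T, hT, hTs, hTsum⟩ := exists_seq_of_zero_of_succ (P := fun m T => HasStrongSum
    (fun α : Sig m => opTensor (C α) (opTensor (A α) ((universalModel n).word α))) T)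
    hT₀ hT₁ hsum₁
  refine ⟨T, hT, hTs, ?_⟩
  rw [hTsum]
  exact le_of_forall_pos_le_add fun ε hε =>
    norm_add_tsum_le hH hF hRe (coeff_one_nonneg hF0) hSig hC0 hD hDs hDle hT₁ hε

end Main

theorem mainTheorem6 {k : ℕ} (n : Fin k → ℕ) (hn : ∀ i, 0 < n i)
    {K : Type v} [NormedAddCommGroup K] [InnerProductSpace ℂ K] [CompleteSpace K]
    {H : Type u} [NormedAddCommGroup H] [InnerProductSpace ℂ H] [CompleteSpace H]
    (hH : ¬ FiniteDimensional ℂ H)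
    (A : PolyWord n → K →L[ℂ] K)
    (hF : IsFreeHolomorphic.{u, v} A)
    (hF0 : 0 ≤ freeEval A (0 : OpTuple n H))
    (hRe : ∀ X ∈ regularPolyball n H,
      (realPart (freeEval A X) : HilbertTensor K H →L[ℂ] HilbertTensor K H) ≤ 1)
    (Sig : ℕ → Set (PolyWord n)) (hSig : IsMinimalOrthogonalExhaustion Sig)
    {E : Type w} [NormedAddCommGroup E] [InnerProductSpace ℂ E] [CompleteSpace E]
    (C : PolyWord n → E →L[ℂ] E) (hC0 : ‖C 1‖ ≤ 1) :
    ((∑' m : ℕ, ⨆ α ∈ Sig (m + 1), ‖C α‖ₑ) ≤ 1 / 2 →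
      ∀ (G : Type x) [NormedAddCommGroup G] [InnerProductSpace ℂ G] [CompleteSpace G],
        ∃ T : ℕ → OpTuple n G →
            (HilbertTensor E (HilbertTensor K G) →L[ℂ] HilbertTensor E (HilbertTensor K G)),
          (∀ m, ∀ X ∈ closure (regularPolyball n G),
            HasStrongSum (fun α : Sig m => opTensor (C α) (opTensor (A α) (X.word α)))
              (T m X)) ∧
          (∑' m : ℕ, ⨆ X ∈ closure (regularPolyball n G), ‖T m X‖ₑ) ≤ ‖A 1‖ₑ + ‖1 - A 1‖ₑ) ∧
    (∀ D : ℕ → E →L[ℂ] E,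
      (∀ m, HasStrongSum
        (fun α : Sig (m + 1) => ContinuousLinearMap.adjoint (C α) * C α) (D m)) →
      (∑' m : ℕ, ‖D m‖ₑ ^ (1 / 2 : ℝ)) ≤ 1 / 2 →
        ∃ T : ℕ → (HilbertTensor E (HilbertTensor K (PolyFock n)) →L[ℂ]
            HilbertTensor E (HilbertTensor K (PolyFock n))),
          (∀ m, HasStrongSum
            (fun α : Sig m => opTensor (C α) (opTensor (A α) ((universalModel n).word α)))
            (T m)) ∧
          Summable (fun m => ‖T m‖) ∧ ‖∑' m, T m‖ ≤ 1) := by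

  exact ⟨fun hC G _ _ _ => exists_sums_of_tsum_iSup_norm_le hH hF hRe hSig hC0 hC G,
    fun D hD hD2 => exists_sums_of_tsum_norm_rpow_le hH hF hF0 hRe hSig hC0 D hD hD2⟩
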